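/- Let $\mathcal C=(C,P,\partial)$ be a crossed module: groups $C,P$, an action $(p,c)\mapsto{}^pc$ of $P$ on $C$ by automorphisms and a homomorphism $\partial:C\to P$ with $\partial({}^pc)=p\,\partial c\,p^{-1}$ and ${}^{\partial c}c'=cc'c^{-1}$. Let $\mathbb K$ be a field. A formal $\mathcal C$-map on a closed oriented $1$-manifold is a finite family of oriented, pointed circles, each subdivided into edges labelled by elements of $P$; write $(g)$ for the circle with a single edge labelled $g$. A formal $\mathcal C$-cobordism is a compact oriented surface $M$ with boundary $-S_0\sqcup S_1$, decomposed into cells, with labels $p_e\in P$ on the oriented edges and $c_f\in C$ on the $2$-cells with chosen start vertices, which restricts to the given labels on $S_0$ and $S_1$ and satisfies $\partial c_f=$ the product of the edge labels around $f$, read from the start vertex (moving the start vertex back along a path with label $p$ replaces $c_f$ by ${}^pc_f$). Two such are equivalent if, up to isomorphism and relative to the boundary, they are connected by cellular formal $\mathcal C$-maps (satisfying the cocycle condition on $3$-cells) on cell decompositions of $M\times[0,1]$; this relation is generated by isomorphism, by combining two distinct adjacent $2$-cells into one (whose label, from a start vertex common to both at the end of the erased edge, is the product of the two labels), and by absorbing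 into a $2$-cell an edge that ends at a free vertex inside it. A formal HQFT $\tau$ over $\mathbb K$ with background $\mathcal C$ is a symmetric monoidal assignment of finite-dimensional $\mathbb K$-vector spaces to formal $\mathcal C$-maps on $1$-manifolds and of linear maps to formal $\mathcal C$-cobordisms, which takes equal values on equivalent cobordisms and is compatible with gluing, identity cylinders and disjoint unions (with $\tau(\emptyset)\cong\mathbb K$ and $\tau(S\sqcup T)\cong\tau(S)\otimes\tau(T)$). Write $L_g=\tau((g))$. For $c\in C$ and $g,h\in P$ let * $\ell_c:\mathbb K\to L_{\partial c}$ be the map of the disc $\mathrm{Disc}(c)$ with one $2$-cell labelled $c$, and $\tilde c=\ell_c(1)$; * $\theta_{(c,g)}:L_g\to L_{\partial c\cdot g}$ be the map of the annulus $(Cyl;c,g,1)$ with one $2$-cell labelled $c$, whose base points are joined by an edge labelled $1$; * $\mu:L_g\otimes L_h\to L_{gh}$ be the map of the disc with two holes $(D;1,g,h)$ with one $2$-cell labelled $1$, whose base points are joined by edges labelled $1$. It defines the product $\cdot$ of $L=\bigoplus_{g\in P}L_g$. **Proposition and Corollary.** For all $c\in C$ and $g\in P$: 1. the composite $\mathcal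 C$-cobordism $(g)\cong\emptyset\sqcup(g)\xrightarrow{\ \mathrm{Disc}(c)\,\sqcup\,1_{(g)}\ }(\partial c)\sqcup(g)\xrightarrow{\ (D;1,\partial c,g)\ }(\partial c\cdot g)$ is equivalent to the annulus $(Cyl;c,g,1)$; 2. $\theta_{(c,g)}$ is an isomorphism; 3. the composite $$L_g\xrightarrow{\ \cong\ }\mathbb K\otimes L_g\xrightarrow{\ \ell_c\otimes L_g\ }L_{\partial c}\otimes L_g\xrightarrow{\ \mu\ }L_{\partial c\cdot g}$$ is equal to $\theta_{(c,g)}$; 4. $\theta_{(c,g)}(x)=\tilde c\cdot x$ in $L$ for every $x\in L_g$. -/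

import Mathlib

open scoped TensorProduct DirectSum

universe u v w

/-- A crossed module `(C, P, ∂)`; the action of `P` on `C` by automorphisms is the class
`MulDistribMulAction P C`. -/
structure CrossedModule (C : Type u) (P : Type v) [Group C] [Group P]
    [MulDistribMulAction P C] where
  bd : C →* P
  bd_smul : ∀ (p : P) (c : C), bd (p • c) = p * bd c * p⁻¹
  peiffer : ∀ c c' : C, bd c • c' = c * c' * c⁻¹

/-- A formal circuit: an oriented circle with a start vertex, subdivided into `n + 1` edges which
are labelled, in order, by elements of `P`. -/
structure FormalCircuit (P : Type v) where
  n : ℕ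
  label : Fin (n + 1) → P

/-- A closed oriented 1-manifold with a formal map: a finite family of formal circuits. -/
structure FormalOneManifold (P : Type v) where
  ι : Type
  finite_ι : Finite ι
  circuit : ι → FormalCircuit P

namespace FormalOneManifold

variable {P : Type v}

/-- The edges of the 1-manifold. -/
def Edge (S : FormalOneManifold P) : Type := Σ i : S.ι, Fin ((S.circuit i).n + 1)

instance (S : FormalOneManifold P) : Finite S.Edge :=
  haveI := S.finite_ι
  inferInstanceAs (Finite (Σ i : S.ι, Fin ((S.circuit i).n + 1)))

/-- The edge that follows a given edge on its (cyclically ordered) circuit. -/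
def succ (S : FormalOneManifold P) : Equiv.Perm S.Edge :=
  Equiv.sigmaCongrRight fun i => Equiv.addRight (1 : Fin ((S.circuit i).n + 1))

/-- The label of an edge, which is read along the orientation. -/
def label (S : FormalOneManifold P) (e : S.Edge) : P := (S.circuit e.1).label e.2

/-- The position of an edge in its circuit, counted from the start vertex. -/
def pos (S : FormalOneManifold P) (e : S.Edge) : ℕ := (e.2 : ℕ)

/-- The empty 1-manifold. -/
def empty : FormalOneManifold P := ⟨Empty, inferInstance, fun i => i.elim⟩

/-- A circle with one vertex and one edge, labelled `g`. -/
def circle (g : P) : FormalOneManifold P := ⟨Unit, inferInstance, fun _ => ⟨0, fun _ => g⟩⟩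

instance (g : P) : Unique (circle g).Edge where
  default := ⟨(), (0 : Fin 1)⟩
  uniq := by
    rintro ⟨⟨⟩, i⟩
    exact congrArg (Sigma.mk ()) (Subsingleton.elim (α := Fin 1) i 0)

/-- Disjoint union. -/
def sum (S T : FormalOneManifold P) : FormalOneManifold P :=
  ⟨S.ι ⊕ T.ι, haveI := S.finite_ι; haveI := T.finite_ι; inferInstance,
    Sum.elim S.circuit T.circuit⟩

/-- The edges of a disjoint union. -/
def sumEdge (S T : FormalOneManifold P) : (S.sum T).Edge ≃ S.Edge ⊕ T.Edge where
  toFun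
    | ⟨Sum.inl i, k⟩ => Sum.inl ⟨i, k⟩
    | ⟨Sum.inr i, k⟩ => Sum.inr ⟨i, k⟩
  invFun
    | Sum.inl ⟨i, k⟩ => ⟨Sum.inl i, k⟩
    | Sum.inr ⟨i, k⟩ => ⟨Sum.inr i, k⟩
  left_inv := by rintro ⟨i | i, k⟩ <;> rfl
  right_inv := by rintro (⟨i, k⟩ | ⟨i, k⟩) <;> rfl

/-- An isomorphism of 1-manifolds with formal maps: it preserves the cyclic orders (hence the
orientations), the labels and the start vertices. -/
structure Iso (S T : FormalOneManifold P) where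
  toEquiv : S.Edge ≃ T.Edge
  succ_comm : ∀ e, toEquiv (S.succ e) = T.succ (toEquiv e)
  label_comm : ∀ e, T.label (toEquiv e) = S.label e
  pos_comm : ∀ e, T.pos (toEquiv e) = S.pos e

namespace Iso

/-- The identity. -/
def refl (S : FormalOneManifold P) : Iso S S :=
  ⟨Equiv.refl _, fun _ => rfl, fun _ => rfl, fun _ => rfl⟩

/-- `S ≅ S ⊔ ∅`. -/
def toSumEmpty (S : FormalOneManifold P) : Iso S (S.sum empty) where
  toEquiv :=
    { toFun := fun e => ⟨Sum.inl e.1, e.2⟩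
      invFun := fun e => match e with
        | ⟨Sum.inl i, k⟩ => ⟨i, k⟩
      left_inv := by rintro ⟨i, k⟩; rfl
      right_inv := by rintro ⟨i | i, k⟩; · rfl
                      · exact i.elim }
  succ_comm := fun _ => rfl
  label_comm := fun _ => rfl
  pos_comm := fun _ => rfl

/-- `S ≅ ∅ ⊔ S`. -/
def toEmptySum (S : FormalOneManifold P) : Iso S (empty.sum S) where
  toEquiv :=
    { toFun := fun e => ⟨Sum.inr e.1, e.2⟩
      invFun := fun e => match e with
        | ⟨Sum.inr i, k⟩ => ⟨i, k⟩
      left_inv := by rintro ⟨i, k⟩; rfl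
      right_inv := by rintro ⟨i | i, k⟩
                      · exact i.elim
                      · rfl }
  succ_comm := fun _ => rfl
  label_comm := fun _ => rfl
  pos_comm := fun _ => rfl

/-- `(S ⊔ T) ⊔ U ≅ S ⊔ (T ⊔ U)`. -/
def assoc (S T U : FormalOneManifold P) : Iso ((S.sum T).sum U) (S.sum (T.sum U)) where
  toEquiv :=
    { toFun := fun e => match e with
        | ⟨Sum.inl (Sum.inl i), k⟩ => ⟨Sum.inl i, k⟩
        | ⟨Sum.inl (Sum.inr i), k⟩ => ⟨Sum.inr (Sum.inl i), k⟩
        | ⟨Sum.inr i, k⟩ => ⟨Sum.inr (Sum.inr i), k⟩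
      invFun := fun e => match e with
        | ⟨Sum.inl i, k⟩ => ⟨Sum.inl (Sum.inl i), k⟩
        | ⟨Sum.inr (Sum.inl i), k⟩ => ⟨Sum.inl (Sum.inr i), k⟩
        | ⟨Sum.inr (Sum.inr i), k⟩ => ⟨Sum.inr i, k⟩
      left_inv := by rintro ⟨(i | i) | i, k⟩ <;> rfl
      right_inv := by rintro ⟨i | i | i, k⟩ <;> rfl }
  succ_comm := by rintro ⟨(i | i) | i, k⟩ <;> rfl
  label_comm := by rintro ⟨(i | i) | i, k⟩ <;> rfl
  pos_comm := by rintro ⟨(i | i) | i, k⟩ <;> rfl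

/-- `S ⊔ T ≅ T ⊔ S`. -/
def swap (S T : FormalOneManifold P) : Iso (S.sum T) (T.sum S) where
  toEquiv :=
    { toFun := fun e => match e with
        | ⟨Sum.inl i, k⟩ => ⟨Sum.inr i, k⟩
        | ⟨Sum.inr i, k⟩ => ⟨Sum.inl i, k⟩
      invFun := fun e => match e with
        | ⟨Sum.inl i, k⟩ => ⟨Sum.inr i, k⟩
        | ⟨Sum.inr i, k⟩ => ⟨Sum.inl i, k⟩
      left_inv := by rintro ⟨i | i, k⟩ <;> rfl
      right_inv := by rintro ⟨i | i, k⟩ <;> rfl }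
  succ_comm := by rintro ⟨i | i, k⟩ <;> rfl
  label_comm := by rintro ⟨i | i, k⟩ <;> rfl
  pos_comm := by rintro ⟨i | i, k⟩ <;> rfl

end Iso

end FormalOneManifold

/-- `y` is the first member of `A` in the sequence `x, f x, f (f x), …`. -/
def FirstHit {α : Type} (f : α → α) (A : Set α) (x y : α) : Prop :=
  y ∈ A ∧ ∃ n : ℕ, f^[n] x = y ∧ ∀ i < n, f^[i] x ∉ A

/-- A first hit is carried along an injection that intertwines the two maps off the target. -/
theorem FirstHit.image {α β : Type} {f : α → α} {A : Set α} {g : β → β} {B : Set β} {x y : α}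
    (h : FirstHit f A x y) (j : α → β) (hy : j y ∈ B) (hA : ∀ a, a ∉ A → j a ∉ B)
    (hf : ∀ a, a ∉ A → g (j a) = j (f a)) : FirstHit g B (j x) (j y) := by
  obtain ⟨-, n, hn, hi⟩ := h
  have key : ∀ m ≤ n, g^[m] (j x) = j (f^[m] x) := by
    intro m
    induction m with
    | zero => intro _; rfl
    | succ m ih =>
      intro hm
      rw [Function.iterate_succ_apply', ih (by omega), Function.iterate_succ_apply',
        hf _ (hi m (by omega))]
  refine ⟨hy, n, by rw [key n le_rfl, hn], fun i hin => ?_⟩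
  rw [key i hin.le]
  exact hA _ (hi i hin)

/-- The product `p d * p (f d) * ⋯ * p (f^[n-1] d)` of the labels along a path. -/
def pathProd {α : Type} {P : Type v} [Group P] (f : α → α) (p : α → P) (n : ℕ) (d : α) : P :=
  ((List.range n).map fun k => p (f^[k] d)).prod

/-- A formal `𝒞`-cobordism from `S` to `T`: a compact oriented surface with boundary `-S ⊔ T`,
with a cell decomposition and a cellular formal `𝒞`-map.

The surface is glued from oriented polygons (the 2-cells). `Side` is the set of all sides of
the polygons, each directed along the boundary of its polygon, and `next` sends a side to the
following one, so that the 2-cells are the cycles of `next`. An interior edge is a pair of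
distinct sides `d`, `opp d`, glued with opposite directions; a side with `opp d = d` is a boundary
edge. With these conventions a boundary side is directed as the boundary of the oriented surface,
hence along the circuits of `T` and against the circuits of `S`. The map `next ∘ opp` turns
around a vertex to the next side that leaves it, so `next d`, `next (opp (next d))`, … run
through the sides that leave the end of a boundary side `d`, up to the boundary side that
follows `d`. -/
structure FormalCobordism {C : Type u} {P : Type v} [Group C] [Group P] [MulDistribMulAction P C]
    (X : CrossedModule C P) (S T : FormalOneManifold P) where
  Side : Type
  finite_side : Finite Side
  next : Equiv.Perm Side
  opp : Side → Side
  opp_opp : ∀ d, opp (opp d) = d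
  /-- the side that is the given edge of `S` -/
  inBd : S.Edge → Side
  /-- the side that is the given edge of `T` -/
  outBd : T.Edge → Side
  inBd_injective : Function.Injective inBd
  outBd_injective : Function.Injective outBd
  inBd_ne_outBd : ∀ e f, inBd e ≠ outBd f
  opp_eq_iff : ∀ d, opp d = d ↔ (∃ e, inBd e = d) ∨ ∃ f, outBd f = d
  in_succ : ∀ e, FirstHit (fun d => next (opp d)) {d | opp d = d} (next (inBd (S.succ e))) (inBd e)
  out_succ : ∀ f, FirstHit (fun d => next (opp d)) {d | opp d = d} (next (outBd f))
    (outBd (T.succ f))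
  /-- the labels of the edges, read along the sides -/
  p : Side → P
  p_opp : ∀ d, opp d ≠ d → p (opp d) = (p d)⁻¹
  p_in : ∀ e, p (inBd e) = (S.label e)⁻¹
  p_out : ∀ f, p (outBd f) = T.label f
  /-- `c d` is the label of the 2-cell of `d` when the initial vertex of `d` is taken as its start
  vertex. -/
  c : Side → C
  /-- change of start vertex -/
  c_next : ∀ d, c (next d) = (p d)⁻¹ • c d
  /-- the boundary condition: `∂` of the label is the product of the edge labels around the cell -/
  bd_c : ∀ d, X.bd (c d) = pathProd next p (Function.minimalPeriod next d) d

namespace FormalCobordism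

section Helpers

theorem iterate_inl {α β : Type} (f : α → α) (g : β → β) (n : ℕ) (a : α) :
    (Sum.map f g)^[n] (Sum.inl a) = Sum.inl (f^[n] a) := by
  induction n generalizing a with
  | zero => rfl
  | succ n ih => simp [Function.iterate_succ_apply, ih]

theorem iterate_inr {α β : Type} (f : α → α) (g : β → β) (n : ℕ) (b : β) :
    (Sum.map f g)^[n] (Sum.inr b) = Sum.inr (g^[n] b) := by
  induction n generalizing b with
  | zero => rfl
  | succ n ih => simp [Function.iterate_succ_apply, ih]

theorem minimalPeriod_inl {α β : Type} (f : α → α) (g : β → β) (a : α) :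
    Function.minimalPeriod (Sum.map f g) (Sum.inl a) = Function.minimalPeriod f a := by
  rw [Function.minimalPeriod_eq_minimalPeriod_iff]
  intro n
  simp [Function.IsPeriodicPt, Function.IsFixedPt, iterate_inl]

theorem minimalPeriod_inr {α β : Type} (f : α → α) (g : β → β) (b : β) :
    Function.minimalPeriod (Sum.map f g) (Sum.inr b) = Function.minimalPeriod g b := by
  rw [Function.minimalPeriod_eq_minimalPeriod_iff]
  intro n
  simp [Function.IsPeriodicPt, Function.IsFixedPt, iterate_inr]

theorem pathProd_inl {α β : Type} {P : Type v} [Group P] (f : α → α) (g : β → β) (p : α → P)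
    (q : β → P) (n : ℕ) (a : α) :
    pathProd (Sum.map f g) (Sum.elim p q) n (Sum.inl a) = pathProd f p n a := by
  simp [pathProd, iterate_inl]

theorem pathProd_inr {α β : Type} {P : Type v} [Group P] (f : α → α) (g : β → β) (p : α → P)
    (q : β → P) (n : ℕ) (b : β) :
    pathProd (Sum.map f g) (Sum.elim p q) n (Sum.inr b) = pathProd g q n b := by
  simp [pathProd, iterate_inr]

theorem iterate_finAdd (n m : ℕ) (x : Fin (n + 1)) :
    (fun y : Fin (n + 1) => y + 1)^[m] x = x + (Fin.ofNat (n + 1) m) := by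
  induction m with
  | zero => simp
  | succ m ih =>
    rw [Function.iterate_succ_apply', ih, add_assoc]
    congr 1
    ext
    simp [Fin.val_add]

theorem minimalPeriod_finAdd (n : ℕ) (x : Fin (n + 1)) :
    Function.minimalPeriod (fun y : Fin (n + 1) => y + 1) x = n + 1 := by
  apply Nat.dvd_antisymm
  · apply Function.IsPeriodicPt.minimalPeriod_dvd
    rw [Function.IsPeriodicPt, Function.IsFixedPt, iterate_finAdd]
    simp
  · have h := Function.isPeriodicPt_minimalPeriod (fun y : Fin (n + 1) => y + 1) x
    rw [Function.IsPeriodicPt, Function.IsFixedPt, iterate_finAdd] at h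
    have h2 := add_eq_left.mp h
    rw [Fin.ext_iff] at h2
    simpa [Nat.dvd_iff_mod_eq_zero] using h2

theorem minimalPeriod_square {α : Type} (e : α) (i : Fin 4) :
    Function.minimalPeriod (Equiv.prodCongr (Equiv.refl α) (Equiv.addRight (1 : Fin 4))) (e, i) =
      4 := by
  have key : ∀ n, (Equiv.prodCongr (Equiv.refl α) (Equiv.addRight (1 : Fin 4)))^[n] (e, i) =
      (e, (fun y : Fin (3 + 1) => y + 1)^[n] i) := by
    intro n
    induction n with
    | zero => rfl
    | succ n ih => rw [Function.iterate_succ_apply', ih, Function.iterate_succ_apply']; rfl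
  refine Eq.trans ?_ (minimalPeriod_finAdd 3 i)
  rw [Function.minimalPeriod_eq_minimalPeriod_iff]
  intro n
  rw [Function.IsPeriodicPt, Function.IsFixedPt, key]
  simp [Function.IsPeriodicPt, Function.IsFixedPt]

theorem pathProd_four {α : Type} {P : Type v} [Group P] (f : α → α) (p : α → P) (d : α) :
    pathProd f p 4 d = p d * (p (f d) * (p (f (f d)) * p (f (f (f d))))) := by
  simp [pathProd, List.range_succ]

theorem pathProd_seven {α : Type} {P : Type v} [Group P] (f : α → α) (p : α → P) (d : α) :
    pathProd f p 7 d = p d * (p (f d) * (p (f (f d)) * (p (f (f (f d))) * (p (f (f (f (f d)))) *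
      (p (f (f (f (f (f d))))) * p (f (f (f (f (f (f d)))))))))) ) := by
  simp [pathProd, List.range_succ]

end Helpers

variable {C : Type u} {P : Type v} [Group C] [Group P] [MulDistribMulAction P C]
  {X : CrossedModule C P} {S T U S' T' : FormalOneManifold P}

theorem opp_inBd (F : FormalCobordism X S T) (e : S.Edge) : F.opp (F.inBd e) = F.inBd e :=
  (F.opp_eq_iff _).2 (Or.inl ⟨e, rfl⟩)

theorem opp_outBd (F : FormalCobordism X S T) (f : T.Edge) : F.opp (F.outBd f) = F.outBd f :=
  (F.opp_eq_iff _).2 (Or.inr ⟨f, rfl⟩)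

section Comp

variable (F : FormalCobordism X S T) (G : FormalCobordism X T U)

open Classical in
/-- The gluing of the sides of two cobordisms with the common end `T`. -/
noncomputable def compOpp : F.Side ⊕ G.Side → F.Side ⊕ G.Side
  | Sum.inl d => if h : ∃ e, F.outBd e = d then Sum.inr (G.inBd h.choose) else Sum.inl (F.opp d)
  | Sum.inr d => if h : ∃ e, G.inBd e = d then Sum.inl (F.outBd h.choose) else Sum.inr (G.opp d)

theorem compOpp_outBd (e : T.Edge) :
    compOpp F G (Sum.inl (F.outBd e)) = Sum.inr (G.inBd e) := by
  have h : ∃ e', F.outBd e' = F.outBd e := ⟨e, rfl⟩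
  simp only [compOpp, dif_pos h]
  rw [F.outBd_injective h.choose_spec]

theorem compOpp_inBd (e : T.Edge) :
    compOpp F G (Sum.inr (G.inBd e)) = Sum.inl (F.outBd e) := by
  have h : ∃ e', G.inBd e' = G.inBd e := ⟨e, rfl⟩
  simp only [compOpp, dif_pos h]
  rw [G.inBd_injective h.choose_spec]

theorem compOpp_inl (d : F.Side) (h : ∀ e, F.outBd e ≠ d) :
    compOpp F G (Sum.inl d) = Sum.inl (F.opp d) := by
  have h' : ¬ ∃ e, F.outBd e = d := fun ⟨e, he⟩ => h e he
  simp only [compOpp, dif_neg h']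

theorem compOpp_inr (d : G.Side) (h : ∀ e, G.inBd e ≠ d) :
    compOpp F G (Sum.inr d) = Sum.inr (G.opp d) := by
  have h' : ¬ ∃ e, G.inBd e = d := fun ⟨e, he⟩ => h e he
  simp only [compOpp, dif_neg h']

theorem not_outBd_opp {d : F.Side} (h : ∀ e, F.outBd e ≠ d) (e : T.Edge) :
    F.outBd e ≠ F.opp d := by
  intro he
  apply h e
  rw [← F.opp_opp d, ← he, F.opp_outBd]

theorem not_inBd_opp {d : G.Side} (h : ∀ e, G.inBd e ≠ d) (e : T.Edge) :
    G.inBd e ≠ G.opp d := by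
  intro he
  apply h e
  rw [← G.opp_opp d, ← he, G.opp_inBd]

/-- The composite `F #_T G`: every edge of the outgoing end of `F` is glued to the same edge
of the incoming end of `G`. -/
noncomputable def comp : FormalCobordism X S U where
  Side := F.Side ⊕ G.Side
  finite_side := haveI := F.finite_side; haveI := G.finite_side; inferInstance
  next := Equiv.sumCongr F.next G.next
  opp := compOpp F G
  opp_opp := by
    rintro (d | d)
    · by_cases h : ∃ e, F.outBd e = d
      · obtain ⟨e, rfl⟩ := h
        rw [compOpp_outBd, compOpp_inBd]
      · have h' : ∀ e, F.outBd e ≠ d := fun e he => h ⟨e, he⟩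
        rw [compOpp_inl F G d h', compOpp_inl F G _ (not_outBd_opp F h'), F.opp_opp]
    · by_cases h : ∃ e, G.inBd e = d
      · obtain ⟨e, rfl⟩ := h
        rw [compOpp_inBd, compOpp_outBd]
      · have h' : ∀ e, G.inBd e ≠ d := fun e he => h ⟨e, he⟩
        rw [compOpp_inr F G d h', compOpp_inr F G _ (not_inBd_opp G h'), G.opp_opp]
  inBd := fun e => Sum.inl (F.inBd e)
  outBd := fun e => Sum.inr (G.outBd e)
  inBd_injective := Sum.inl_injective.comp F.inBd_injective
  outBd_injective := Sum.inr_injective.comp G.outBd_injective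
  inBd_ne_outBd := by intro e f h; cases h
  opp_eq_iff := by
    rintro (d | d)
    · by_cases h : ∃ e, F.outBd e = d
      · obtain ⟨e, rfl⟩ := h
        rw [compOpp_outBd]
        simpa using fun e' => F.inBd_ne_outBd e' e
      · have h' : ∀ e, F.outBd e ≠ d := fun e he => h ⟨e, he⟩
        rw [compOpp_inl F G d h']
        simp [F.opp_eq_iff, h']
    · by_cases h : ∃ e, G.inBd e = d
      · obtain ⟨e, rfl⟩ := h
        rw [compOpp_inBd]
        simpa using fun e' => (G.inBd_ne_outBd e e').symm
      · have h' : ∀ e, G.inBd e ≠ d := fun e he => h ⟨e, he⟩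
        rw [compOpp_inr F G d h']
        simp [G.opp_eq_iff, h']
  in_succ := by
    intro e
    refine (F.in_succ e).image (g := fun d => Equiv.sumCongr F.next G.next (compOpp F G d))
      (B := {d | compOpp F G d = d}) (fun d => (Sum.inl d : F.Side ⊕ G.Side)) ?_ ?_ ?_
    · show compOpp F G _ = _
      rw [compOpp_inl F G _ fun f hf => F.inBd_ne_outBd e f hf.symm, F.opp_inBd]
    · intro a ha h
      have h' : ∀ e, F.outBd e ≠ a := by
        rintro e rfl; exact ha (F.opp_outBd e)
      apply ha
      have h2 : compOpp F G (Sum.inl a) = Sum.inl a := h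
      rw [compOpp_inl F G a h'] at h2
      exact Sum.inl_injective h2
    · intro a ha
      have h' : ∀ e, F.outBd e ≠ a := by
        rintro e rfl; exact ha (F.opp_outBd e)
      show Equiv.sumCongr F.next G.next (compOpp F G (Sum.inl a)) = _
      rw [compOpp_inl F G a h']
      rfl
  out_succ := by
    intro e
    refine (G.out_succ e).image (g := fun d => Equiv.sumCongr F.next G.next (compOpp F G d))
      (B := {d | compOpp F G d = d}) (fun d => (Sum.inr d : F.Side ⊕ G.Side)) ?_ ?_ ?_
    · show compOpp F G _ = _
      rw [compOpp_inr F G _ fun f hf => G.inBd_ne_outBd f _ hf, G.opp_outBd]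
    · intro a ha h
      have h' : ∀ e, G.inBd e ≠ a := by
        rintro e rfl; exact ha (G.opp_inBd e)
      apply ha
      have h2 : compOpp F G (Sum.inr a) = Sum.inr a := h
      rw [compOpp_inr F G a h'] at h2
      exact Sum.inr_injective h2
    · intro a ha
      have h' : ∀ e, G.inBd e ≠ a := by
        rintro e rfl; exact ha (G.opp_inBd e)
      show Equiv.sumCongr F.next G.next (compOpp F G (Sum.inr a)) = _
      rw [compOpp_inr F G a h']
      rfl
  p := Sum.elim F.p G.p
  p_opp := by
    rintro (d | d) hd
    · by_cases h : ∃ e, F.outBd e = d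
      · obtain ⟨e, rfl⟩ := h
        rw [compOpp_outBd]
        simp [F.p_out, G.p_in]
      · have h' : ∀ e, F.outBd e ≠ d := fun e he => h ⟨e, he⟩
        rw [compOpp_inl F G d h'] at hd ⊢
        exact F.p_opp d fun h => hd (congrArg _ h)
    · by_cases h : ∃ e, G.inBd e = d
      · obtain ⟨e, rfl⟩ := h
        rw [compOpp_inBd]
        simp [F.p_out, G.p_in]
      · have h' : ∀ e, G.inBd e ≠ d := fun e he => h ⟨e, he⟩
        rw [compOpp_inr F G d h'] at hd ⊢
        exact G.p_opp d fun h => hd (congrArg _ h)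
  p_in := F.p_in
  p_out := G.p_out
  c := Sum.elim F.c G.c
  c_next := by
    rintro (d | d)
    · exact F.c_next d
    · exact G.c_next d
  bd_c := by
    rintro (d | d)
    · exact (F.bd_c d).trans (by
        change _ = pathProd (Sum.map F.next G.next) _
          (Function.minimalPeriod (Sum.map F.next G.next) _) _
        rw [pathProd_inl, minimalPeriod_inl])
    · exact (G.bd_c d).trans (by
        change _ = pathProd (Sum.map F.next G.next) _
          (Function.minimalPeriod (Sum.map F.next G.next) _) _
        rw [pathProd_inr, minimalPeriod_inr])

end Comp

/-- The disjoint union of two formal cobordisms. -/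
def sum (F : FormalCobordism X S T) (G : FormalCobordism X S' T') :
    FormalCobordism X (S.sum S') (T.sum T') where
  Side := F.Side ⊕ G.Side
  finite_side := haveI := F.finite_side; haveI := G.finite_side; inferInstance
  next := Equiv.sumCongr F.next G.next
  opp := Sum.map F.opp G.opp
  opp_opp := by rintro (d | d) <;> simp [F.opp_opp, G.opp_opp]
  inBd := fun e => Sum.map F.inBd G.inBd (S.sumEdge S' e)
  outBd := fun e => Sum.map F.outBd G.outBd (T.sumEdge T' e)
  inBd_injective :=
    (Sum.map_injective.2 ⟨F.inBd_injective, G.inBd_injective⟩).comp (S.sumEdge S').injective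
  outBd_injective :=
    (Sum.map_injective.2 ⟨F.outBd_injective, G.outBd_injective⟩).comp (T.sumEdge T').injective
  inBd_ne_outBd := by
    intro e f
    rcases S.sumEdge S' e with e | e <;> rcases T.sumEdge T' f with f | f <;>
      simp [F.inBd_ne_outBd, G.inBd_ne_outBd]
  opp_eq_iff := by
    intro d
    rw [(S.sumEdge S').symm.surjective.exists, (T.sumEdge T').symm.surjective.exists]
    simp only [Equiv.apply_symm_apply]
    rcases d with d | d <;> simp [F.opp_eq_iff, G.opp_eq_iff]
  in_succ := by
    rintro ⟨i | i, k⟩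
    · exact (F.in_succ ⟨i, k⟩).image (fun d => (Sum.inl d : F.Side ⊕ G.Side))
        (congrArg Sum.inl (F.opp_inBd _)) (fun a ha h => ha (Sum.inl_injective h)) fun a _ => rfl
    · exact (G.in_succ ⟨i, k⟩).image (fun d => (Sum.inr d : F.Side ⊕ G.Side))
        (congrArg Sum.inr (G.opp_inBd _)) (fun a ha h => ha (Sum.inr_injective h)) fun a _ => rfl
  out_succ := by
    rintro ⟨i | i, k⟩
    · exact (F.out_succ ⟨i, k⟩).image (fun d => (Sum.inl d : F.Side ⊕ G.Side))
        (congrArg Sum.inl (F.opp_outBd _)) (fun a ha h => ha (Sum.inl_injective h)) fun a _ => rfl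
    · exact (G.out_succ ⟨i, k⟩).image (fun d => (Sum.inr d : F.Side ⊕ G.Side))
        (congrArg Sum.inr (G.opp_outBd _)) (fun a ha h => ha (Sum.inr_injective h)) fun a _ => rfl
  p := Sum.elim F.p G.p
  p_opp := by
    rintro (d | d) hd
    · exact F.p_opp d fun h => hd (congrArg _ h)
    · exact G.p_opp d fun h => hd (congrArg _ h)
  p_in := by
    rintro ⟨i | i, k⟩
    · exact F.p_in ⟨i, k⟩
    · exact G.p_in ⟨i, k⟩
  p_out := by
    rintro ⟨i | i, k⟩
    · exact F.p_out ⟨i, k⟩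
    · exact G.p_out ⟨i, k⟩
  c := Sum.elim F.c G.c
  c_next := by
    rintro (d | d)
    · exact F.c_next d
    · exact G.c_next d
  bd_c := by
    rintro (d | d)
    · exact (F.bd_c d).trans (by
        change _ = pathProd (Sum.map F.next G.next) _
          (Function.minimalPeriod (Sum.map F.next G.next) _) _
        rw [pathProd_inl, minimalPeriod_inl])
    · exact (G.bd_c d).trans (by
        change _ = pathProd (Sum.map F.next G.next) _
          (Function.minimalPeriod (Sum.map F.next G.next) _) _
        rw [pathProd_inr, minimalPeriod_inr])

/-- The cylinder `S × [0,1]` of an isomorphism `φ : S ≅ T`, with one square for every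
edge of `S`. The sides of the square of `e` are numbered `0` (the edge `φ e` of `T`), `1` (vertical,
at the end of `e`), `2` (the edge `e` of `S`, reversed), `3` (vertical, at the start of `e`). Vertical
edges are labelled by `1`, and so are the 2-cells. -/
def cylinder (X : CrossedModule C P) (φ : FormalOneManifold.Iso S T) : FormalCobordism X S T where
  Side := S.Edge × Fin 4
  finite_side := inferInstance
  next := Equiv.prodCongr (Equiv.refl _) (Equiv.addRight 1)
  opp := fun d => match d with
    | (e, 0) => (e, 0)
    | (e, 1) => (S.succ e, 3)
    | (e, 2) => (e, 2)
    | (e, 3) => (S.succ.symm e, 1)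
  opp_opp := by
    rintro ⟨e, i⟩
    fin_cases i <;> simp
  inBd := fun e => (e, 2)
  outBd := fun f => (φ.toEquiv.symm f, 0)
  inBd_injective := fun e f h => (Prod.mk.inj h).1
  outBd_injective := fun e f h => φ.toEquiv.symm.injective (Prod.mk.inj h).1
  inBd_ne_outBd := by intro e f h; simp at h
  opp_eq_iff := by
    rintro ⟨e, i⟩
    fin_cases i
    · simp only [Fin.zero_eta, true_iff]
      exact Or.inr ⟨φ.toEquiv e, by simp⟩
    · simp
    · simp
    · simp
  in_succ := by
    intro e
    refine ⟨rfl, 1, ?_, ?_⟩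
    · show (S.succ.symm (S.succ e), (2 : Fin 4)) = _
      simp
    · intro i hi
      obtain rfl : i = 0 := by omega
      intro h
      have := (Prod.mk.inj (show (S.succ.symm (S.succ e), (1 : Fin 4)) = (S.succ e, 3) from h)).2
      simp at this
  out_succ := by
    intro f
    refine ⟨rfl, 1, ?_, ?_⟩
    · refine Prod.ext ?_ rfl
      change S.succ (φ.toEquiv.symm f) = φ.toEquiv.symm (T.succ f)
      rw [Equiv.eq_symm_apply, φ.succ_comm, Equiv.apply_symm_apply]
    · intro i hi
      obtain rfl : i = 0 := by omega
      intro h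
      have := (Prod.mk.inj
        (show (S.succ (φ.toEquiv.symm f), (3 : Fin 4)) = (φ.toEquiv.symm f, 1) from h)).2
      simp at this
  p := fun d => ![S.label d.1, 1, (S.label d.1)⁻¹, 1] d.2
  p_opp := by
    rintro ⟨e, i⟩ h
    fin_cases i <;> simp at h ⊢
  p_in := fun e => rfl
  p_out := fun f => by
    show S.label (φ.toEquiv.symm f) = _
    rw [← φ.label_comm, Equiv.apply_symm_apply]
  c := fun _ => 1
  c_next := by simp
  bd_c := by
    rintro ⟨e, i⟩
    rw [show Function.minimalPeriod _ _ = 4 from minimalPeriod_square e i]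
    rw [pathProd_four, map_one]
    fin_cases i
    · change 1 = S.label e * (1 * ((S.label e)⁻¹ * 1))
      simp
    · change 1 = 1 * ((S.label e)⁻¹ * (1 * S.label e))
      simp
    · change 1 = (S.label e)⁻¹ * (1 * (S.label e * 1))
      simp
    · change 1 = 1 * (S.label e * (1 * (S.label e)⁻¹))
      simp

/-- The identity cobordism on `S`. -/
def identity (X : CrossedModule C P) (S : FormalOneManifold P) : FormalCobordism X S S :=
  cylinder X (FormalOneManifold.Iso.refl S)

/-- The formal disc `Disc(c)`: one 2-cell, with one boundary edge. -/
def disc (X : CrossedModule C P) (c : C) :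
    FormalCobordism X FormalOneManifold.empty (FormalOneManifold.circle (X.bd c)) where
  Side := Fin 1
  finite_side := inferInstance
  next := Equiv.refl _
  opp := id
  opp_opp := fun _ => rfl
  inBd := fun e => e.1.elim
  outBd := fun _ => 0
  inBd_injective := fun e => e.1.elim
  outBd_injective := fun _ _ _ => Subsingleton.elim _ _
  inBd_ne_outBd := fun e => e.1.elim
  opp_eq_iff := fun d => ⟨fun _ => Or.inr ⟨⟨(), (0 : Fin 1)⟩, Subsingleton.elim _ _⟩, fun _ => rfl⟩
  in_succ := fun e => e.1.elim
  out_succ := fun _ => ⟨rfl, 0, rfl, fun i hi => absurd hi (Nat.not_lt_zero i)⟩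
  p := fun _ => X.bd c
  p_opp := fun _ h => absurd rfl h
  p_in := fun e => e.1.elim
  p_out := fun _ => rfl
  c := fun _ => c
  c_next := fun d => by
    rw [← map_inv, X.peiffer]
    simp
  bd_c := fun d => by
    rw [show Function.minimalPeriod (Equiv.refl (Fin 1)) d = 1 from
      Function.minimalPeriod_eq_one_iff_isFixedPt.2 rfl]
    simp [pathProd]

/-- The formal annulus `(Cyl; c, g, h)` from the circle `g` to the circle `k`, where
`k = ∂c · h⁻¹ g h`. Its only 2-cell is a square whose sides are, in order, `k` (the outgoing
circle), `h⁻¹`, `g⁻¹` (the incoming circle, reversed) and `h`; the edge `h` leads from the base point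
of the incoming circle to that of the outgoing one, which is the start vertex of the 2-cell. -/
def annulus (X : CrossedModule C P) (c : C) (g h k : P) (hk : k = X.bd c * (h⁻¹ * g * h)) :
    FormalCobordism X (FormalOneManifold.circle g) (FormalOneManifold.circle k) where
  Side := Fin 4
  finite_side := inferInstance
  next := Equiv.addRight 1
  opp := ![0, 3, 2, 1]
  opp_opp := by decide
  inBd := fun _ => 2
  outBd := fun _ => 0
  inBd_injective := fun _ _ _ => Subsingleton.elim _ _
  outBd_injective := fun _ _ _ => Subsingleton.elim _ _
  inBd_ne_outBd := fun _ _ => by decide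
  opp_eq_iff := fun d => by
    fin_cases d <;> simp
  in_succ := fun _ => ⟨rfl, 1, rfl, by decide⟩
  out_succ := fun _ => ⟨rfl, 1, rfl, by decide⟩
  p := ![k, h⁻¹, g⁻¹, h]
  p_opp := by
    intro d hd
    fin_cases d <;> simp at hd ⊢
  p_in := fun _ => rfl
  p_out := fun _ => rfl
  c := ![c, k⁻¹ • c, (h * k⁻¹) • c, (g * h * k⁻¹) • c]
  c_next := by
    have hc : X.bd c • c = c := by rw [X.peiffer]; simp
    intro d
    fin_cases d
    · rfl
    · change (h * k⁻¹) • c = h⁻¹⁻¹ • k⁻¹ • c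
      rw [smul_smul, inv_inv]
    · change (g * h * k⁻¹) • c = g⁻¹⁻¹ • (h * k⁻¹) • c
      rw [smul_smul, inv_inv, mul_assoc]
    · change c = h⁻¹ • (g * h * k⁻¹) • c
      rw [smul_smul, show h⁻¹ * (g * h * k⁻¹) = (X.bd c)⁻¹ by rw [hk]; group, eq_inv_smul_iff, hc]
  bd_c := by
    intro d
    rw [show Function.minimalPeriod (Equiv.addRight (1 : Fin 4)) d = 4 from
      minimalPeriod_finAdd 3 d, pathProd_four]
    fin_cases d
    · change X.bd c = k * (h⁻¹ * (g⁻¹ * h))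
      rw [hk]; group
    · change X.bd (k⁻¹ • c) = h⁻¹ * (g⁻¹ * (h * k))
      rw [X.bd_smul, hk]; group
    · change X.bd ((h * k⁻¹) • c) = g⁻¹ * (h * (k * h⁻¹))
      rw [X.bd_smul, hk]; group
    · change X.bd ((g * h * k⁻¹) • c) = h * (k * (h⁻¹ * g⁻¹))
      rw [X.bd_smul, hk]; group

/-- The formal disc with two holes `(D; c, g₁, g₂)` from the circles `g₁`, `g₂` to the circle `k`,
where `k = ∂c · g₁ g₂`. Its only 2-cell is a heptagon whose sides are, in order, the outgoing circle
`k` (based at `t`), the arc from `t` to the base point `z` of the second hole, that hole reversed,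
the same arc back to `t`, the arc from `t` to the base point `y` of the first hole, that hole
reversed, and the same arc back to `t`. Both arcs are labelled by `1`, and `t` is the start vertex
of the 2-cell. -/
def pants (X : CrossedModule C P) (c : C) (g₁ g₂ k : P) (hk : k = X.bd c * (g₁ * g₂)) :
    FormalCobordism X ((FormalOneManifold.circle g₁).sum (FormalOneManifold.circle g₂))
      (FormalOneManifold.circle k) where
  Side := Fin 7
  finite_side := inferInstance
  next := Equiv.addRight 1
  opp := ![0, 3, 2, 1, 6, 5, 4]
  opp_opp := by decide
  inBd := fun e => Sum.elim (fun _ => 5) (fun _ => 2) e.1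
  outBd := fun _ => 0
  inBd_injective := by
    rintro ⟨⟨⟩ | ⟨⟩, i⟩ ⟨⟨⟩ | ⟨⟩, j⟩ h
    · exact congrArg (Sigma.mk (Sum.inl ())) (Subsingleton.elim (α := Fin 1) i j)
    · simp at h
    · simp at h
    · exact congrArg (Sigma.mk (Sum.inr ())) (Subsingleton.elim (α := Fin 1) i j)
  outBd_injective := fun _ _ _ => Subsingleton.elim _ _
  inBd_ne_outBd := by
    rintro ⟨_ | _, i⟩ f h <;> simp at h
  opp_eq_iff := fun d => by
    have h5 : ∃ e : FormalOneManifold.Edge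
        ((FormalOneManifold.circle g₁).sum (FormalOneManifold.circle g₂)),
        Sum.elim (fun _ => (5 : Fin 7)) (fun _ => 2) e.1 = 5 := ⟨⟨Sum.inl (), (0 : Fin 1)⟩, rfl⟩
    have h2 : ∃ e : FormalOneManifold.Edge
        ((FormalOneManifold.circle g₁).sum (FormalOneManifold.circle g₂)),
        Sum.elim (fun _ => (5 : Fin 7)) (fun _ => 2) e.1 = 2 := ⟨⟨Sum.inr (), (0 : Fin 1)⟩, rfl⟩
    have h0 : ∃ _f : FormalOneManifold.Edge (FormalOneManifold.circle k), (0 : Fin 7) = 0 :=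
      ⟨⟨(), (0 : Fin 1)⟩, rfl⟩
    constructor
    · intro h
      fin_cases d
      · exact Or.inr h0
      · exact absurd h (by decide)
      · exact Or.inl h2
      · exact absurd h (by decide)
      · exact absurd h (by decide)
      · exact Or.inl h5
      · exact absurd h (by decide)
    · rintro (⟨⟨_ | _, _⟩, rfl⟩ | ⟨_, rfl⟩) <;> rfl
  in_succ := by
    rintro ⟨_ | _, i⟩
    · refine ⟨rfl, 1, rfl, fun n hn => ?_⟩
      obtain rfl : n = 0 := by omega
      exact show ¬ ((![0, 3, 2, 1, 6, 5, 4] : Fin 7 → Fin 7) 6 = 6) by decide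
    · refine ⟨rfl, 1, rfl, fun n hn => ?_⟩
      obtain rfl : n = 0 := by omega
      exact show ¬ ((![0, 3, 2, 1, 6, 5, 4] : Fin 7 → Fin 7) 3 = 3) by decide
  out_succ := fun _ => ⟨rfl, 2, rfl, by decide⟩
  p := ![k, 1, g₂⁻¹, 1, 1, g₁⁻¹, 1]
  p_opp := by
    intro d hd
    fin_cases d <;> simp at hd ⊢
  p_in := by rintro ⟨_ | _, i⟩ <;> rfl
  p_out := fun _ => rfl
  c := ![c, k⁻¹ • c, k⁻¹ • c, (g₂ * k⁻¹) • c, (g₂ * k⁻¹) • c, (g₂ * k⁻¹) • c, c]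
  c_next := by
    have hc : X.bd c • c = c := by rw [X.peiffer]; simp
    intro d
    fin_cases d
    · rfl
    · change k⁻¹ • c = (1 : P)⁻¹ • k⁻¹ • c
      simp
    · change (g₂ * k⁻¹) • c = g₂⁻¹⁻¹ • k⁻¹ • c
      rw [smul_smul, inv_inv]
    · change (g₂ * k⁻¹) • c = (1 : P)⁻¹ • (g₂ * k⁻¹) • c
      simp
    · change (g₂ * k⁻¹) • c = (1 : P)⁻¹ • (g₂ * k⁻¹) • c
      simp
    · change c = g₁⁻¹⁻¹ • (g₂ * k⁻¹) • c
      rw [smul_smul, show g₁⁻¹⁻¹ * (g₂ * k⁻¹) = (X.bd c)⁻¹ by rw [hk]; group, eq_inv_smul_iff, hc]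
    · change c = (1 : P)⁻¹ • c
      simp
  bd_c := by
    intro d
    rw [show Function.minimalPeriod (Equiv.addRight (1 : Fin 7)) d = 7 from
      minimalPeriod_finAdd 6 d, pathProd_seven]
    fin_cases d
    · change X.bd c = k * (1 * (g₂⁻¹ * (1 * (1 * (g₁⁻¹ * 1)))))
      rw [hk]; group
    · change X.bd (k⁻¹ • c) = 1 * (g₂⁻¹ * (1 * (1 * (g₁⁻¹ * (1 * k)))))
      rw [X.bd_smul, hk]; group
    · change X.bd (k⁻¹ • c) = g₂⁻¹ * (1 * (1 * (g₁⁻¹ * (1 * (k * 1)))))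
      rw [X.bd_smul, hk]; group
    · change X.bd ((g₂ * k⁻¹) • c) = 1 * (1 * (g₁⁻¹ * (1 * (k * (1 * g₂⁻¹)))))
      rw [X.bd_smul, hk]; group
    · change X.bd ((g₂ * k⁻¹) • c) = 1 * (g₁⁻¹ * (1 * (k * (1 * (g₂⁻¹ * 1)))))
      rw [X.bd_smul, hk]; group
    · change X.bd ((g₂ * k⁻¹) • c) = g₁⁻¹ * (1 * (k * (1 * (g₂⁻¹ * (1 * 1)))))
      rw [X.bd_smul, hk]; group
    · change X.bd c = 1 * (k * (1 * (g₂⁻¹ * (1 * (1 * g₁⁻¹)))))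
      rw [hk]; group

/-! ### Equivalence -/

/-- An isomorphism of formal cobordisms that is the identity on both ends. -/
structure IsIso (F F' : FormalCobordism X S T) (j : F.Side ≃ F'.Side) : Prop where
  next_comm : ∀ d, j (F.next d) = F'.next (j d)
  opp_comm : ∀ d, j (F.opp d) = F'.opp (j d)
  inBd_comm : ∀ e, j (F.inBd e) = F'.inBd e
  outBd_comm : ∀ f, j (F.outBd f) = F'.outBd f
  p_comm : ∀ d, F'.p (j d) = F.p d
  c_comm : ∀ d, F'.c (j d) = F.c d

/-- The cell decomposition of `F'` (with its edge labels) is that of `F` with the interior edge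
`{d, opp d}` erased; `j` identifies the sides of `F'` with the remaining sides of `F`. After the
erasure, the side that follows `x` is the first remaining side met from `next x` on when one turns
around the initial vertex of `next x`. -/
structure IsErasure (F F' : FormalCobordism X S T) (d : F.Side) (j : F'.Side → F.Side) : Prop where
  interior : F.opp d ≠ d
  injective : Function.Injective j
  range : ∀ x, (∃ y, j y = x) ↔ x ≠ d ∧ x ≠ F.opp d
  opp_comm : ∀ x, j (F'.opp x) = F.opp (j x)
  inBd_comm : ∀ e, j (F'.inBd e) = F.inBd e
  outBd_comm : ∀ f, j (F'.outBd f) = F.outBd f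
  p_comm : ∀ x, F'.p x = F.p (j x)
  next_comm : ∀ x, FirstHit (fun y => F.next (F.opp y)) {y | y ≠ d ∧ y ≠ F.opp d}
    (F.next (j x)) (j (F'.next x))

/-- The elementary equivalences between formal cobordisms on the same surface, relative to its
boundary. Apart from isomorphism, each of them is the passage across a single 3-cell of a cellular
decomposition of `M × [0,1]`, whose bottom consists of cells of `F` and whose top is one cell of `F'`;
everything else is constant. The labels are related by the cocycle condition of this 3-cell. Other
3-cells are passed by several such steps and their inverses. -/
inductive Elementary : FormalCobordism X S T → FormalCobordism X S T → Prop
  | iso (F F' : FormalCobordism X S T) (j : F.Side ≃ F'.Side) (h : IsIso F F' j) : Elementary F F'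
  /-- Two different 2-cells with a common edge `d` are combined into one. With the end of `d`
  as start vertex, the label of the new cell is the product of the two labels. -/
  | combine (F F' : FormalCobordism X S T) (d : F.Side) (j : F'.Side → F.Side)
      (h : IsErasure F F' d j) (hcell : ¬ F.next.SameCycle d (F.opp d)) (hd : F.next d ≠ d)
      (hother : ∀ x, ¬ F.next.SameCycle d (j x) → ¬ F.next.SameCycle (F.opp d) (j x) →
        F'.c x = F.c (j x))
      (hnew : ∀ x, j x = F.next d → F'.c x = F.c (F.next d) * F.c (F.opp d)) : Elementary F F'
  /-- An edge `d` that ends in the interior of a 2-cell, at a vertex which lies on no other edge, is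
  absorbed into this 2-cell. -/
  | absorb (F F' : FormalCobordism X S T) (d : F.Side) (j : F'.Side → F.Side)
      (h : IsErasure F F' d j) (hspur : F.next d = F.opp d) (hd : F.next (F.opp d) ≠ d)
      (hc : ∀ x, F'.c x = F.c (j x)) : Elementary F F'

/-- Equivalence of formal cobordisms from `S` to `T`. -/
def Equivalent (F F' : FormalCobordism X S T) : Prop := Relation.EqvGen Elementary F F'

end FormalCobordism

open FormalOneManifold FormalCobordism

/-- A formal (2-dimensional) HQFT over the field `K` with background `X`: a symmetric monoidal
assignment of finite-dimensional vector spaces to formal maps on 1-manifolds, and of linear maps to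
formal cobordisms up to equivalence. The canonical isomorphisms of 1-manifolds act through their
cylinders. -/
structure FormalHQFT {C : Type u} {P : Type v} [Group C] [Group P] [MulDistribMulAction P C]
    (X : CrossedModule C P) (K : Type w) [Field K] where
  space : FormalOneManifold P → Type w
  [addCommGroup : ∀ S, AddCommGroup (space S)]
  [module : ∀ S, Module K (space S)]
  [finite : ∀ S, FiniteDimensional K (space S)]
  map : ∀ {S T : FormalOneManifold P}, FormalCobordism X S T → (space S →ₗ[K] space T)
  map_eq_of_equivalent : ∀ {S T : FormalOneManifold P} (F G : FormalCobordism X S T),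
    F.Equivalent G → map F = map G
  unitIso : space FormalOneManifold.empty ≃ₗ[K] K
  tensorIso : ∀ S T : FormalOneManifold P, space (S.sum T) ≃ₗ[K] space S ⊗[K] space T
  right_unit : ∀ (S : FormalOneManifold P) (x : space S),
    TensorProduct.rid K (space S) (unitIso.toLinearMap.lTensor (space S)
      (tensorIso S FormalOneManifold.empty (map (cylinder X (Iso.toSumEmpty S)) x))) = x
  left_unit : ∀ (S : FormalOneManifold P) (x : space S),
    TensorProduct.lid K (space S) (unitIso.toLinearMap.rTensor (space S)
      (tensorIso FormalOneManifold.empty S (map (cylinder X (Iso.toEmptySum S)) x))) = x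
  associativity : ∀ (S T U : FormalOneManifold P) (x : space ((S.sum T).sum U)),
    (tensorIso T U).toLinearMap.lTensor (space S)
        (tensorIso S (T.sum U) (map (cylinder X (Iso.assoc S T U)) x)) =
      TensorProduct.assoc K (space S) (space T) (space U)
        ((tensorIso S T).toLinearMap.rTensor (space U) (tensorIso (S.sum T) U x))
  symmetry : ∀ (S T : FormalOneManifold P) (x : space (S.sum T)),
    tensorIso T S (map (cylinder X (Iso.swap S T)) x) =
      TensorProduct.comm K (space S) (space T) (tensorIso S T x)
  map_comp : ∀ {S T U : FormalOneManifold P} (F : FormalCobordism X S T)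
    (G : FormalCobordism X T U), map (F.comp G) = map G ∘ₗ map F
  map_identity : ∀ S : FormalOneManifold P, map (identity X S) = LinearMap.id
  map_sum : ∀ {S T S' T' : FormalOneManifold P} (F : FormalCobordism X S T)
    (G : FormalCobordism X S' T') (x : space (S.sum S')),
    tensorIso T T' (map (F.sum G) x) = TensorProduct.map (map F) (map G) (tensorIso S S' x)

namespace FormalHQFT

attribute [instance] FormalHQFT.addCommGroup FormalHQFT.module FormalHQFT.finite

variable {C : Type u} {P : Type v} [Group C] [Group P] [MulDistribMulAction P C]
  {X : CrossedModule C P} {K : Type w} [Field K] (τ : FormalHQFT X K)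

/-- The vector space `L_g`. -/
abbrev L (g : P) : Type w := τ.space (circle g)

/-- The linear map `ℓ_c : K → L_{∂c}` of the formal disc. -/
def discMap (c : C) : K →ₗ[K] τ.L (X.bd c) := τ.map (disc X c) ∘ₗ τ.unitIso.symm.toLinearMap

/-- The element `c̃ = ℓ_c(1)`. -/
def tilde (c : C) : τ.L (X.bd c) := τ.discMap c 1

/-- The linear map `θ_{(c,g)} : L_g → L_{∂c·g}` of the formal annulus `(Cyl; c, g, 1)`. -/
def theta (c : C) (g : P) : τ.L g →ₗ[K] τ.L (X.bd c * g) :=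
  τ.map (annulus X c g 1 (X.bd c * g) (by simp))

/-- The linear map `μ : L_g ⊗ L_h → L_{gh}` of the pair of pants `(D; 1, g, h)`. -/
def mu (g h : P) : τ.L g ⊗[K] τ.L h →ₗ[K] τ.L (g * h) :=
  τ.map (pants X 1 g h (g * h) (by simp)) ∘ₗ (τ.tensorIso (circle g) (circle h)).symm.toLinearMap

/-- `L = ⨁ L_g`. -/
abbrev Total : Type (max v w) := ⨁ g : P, τ.L g

open Classical in
/-- The product of `L`: the bilinear map that is `μ` on homogeneous elements. -/
noncomputable def mulL : τ.Total →ₗ[K] τ.Total →ₗ[K] τ.Total :=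
  DirectSum.toModule K P _ fun g => LinearMap.flip <|
    DirectSum.toModule K P _ fun h => LinearMap.flip <|
      (TensorProduct.mk K (τ.L g) (τ.L h)).compr₂
        (DirectSum.lof K P (fun k => τ.L k) (g * h) ∘ₗ τ.mu g h)

open Classical in
/-- The inclusion of `L_g` into `L`. -/
noncomputable def incl (g : P) : τ.L g →ₗ[K] τ.Total := DirectSum.lof K P (fun k => τ.L k) g

end FormalHQFT

/-!
All cobordisms that occur are surfaces between two circles with a single edge each, and up to
isomorphism they have finitely many sides numbered `0, …, n - 1`. A `Gluing n` records such a cell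
decomposition in a form in which every combinatorial condition can be decided; a `Labelling` adds
the edge and cell labels. The lemmas `Erases.combine` and `Erases.absorb` turn a decidable
comparison of two gluing schemes into an elementary equivalence.

The composite of the disc, the cylinders and the disc with two holes has four 2-cells. Erasing the
boundary of the filling disc multiplies the label `1` of the disc with two holes by `c` and leaves
an edge with a free end, which is absorbed. Erasing the two inner circles then gives an annulus with
one 2-cell labelled `c`, cut open along a path of three edges, all labelled by `1`. No erasure
shortens such a path, because its edges have the same 2-cell on both sides. A chord parallel to the
path is therefore introduced by the inverse of a combination; it cuts off a 2-cell labelled `1`. Now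
an edge of the path lies between two different 2-cells and can be erased, and what remains of the
path ends at a free vertex and is absorbed. The result is `(Cyl; c, g, 1)`, see
`Gluing.disc_pants_equivalent_annulus`.

In the same way `(Cyl; c, g, 1)` followed by `(Cyl; c', k, 1)`, where `k = ∂c · g`, is equivalent to
`(Cyl; c'c, g, 1)` (`Gluing.annulus_comp_equivalent`), and `(Cyl; 1, g, 1)` is the identity
cylinder, so that the annuli labelled by `c` and `c⁻¹` induce mutually inverse maps. The description
of `θ_{(c,g)}` as the multiplication by `c̃` is the image of the first equivalence under the HQFT,
by the compatibility with gluing and disjoint union and the left unit law.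
-/

/-! ### Gluing schemes -/

/-- A gluing scheme with `n` sides for a surface whose boundary is one incoming and one outgoing
circle, each with a single edge: the unlabelled part of a formal cobordism between two such circles.
The list `cells` enumerates the 2-cells; each of them is given by its first side and the remaining
ones in order, so that all conditions can be decided. -/
structure Gluing (n : ℕ) where
  next : Equiv.Perm (Fin n)
  opp : Fin n → Fin n
  inSide : Fin n
  outSide : Fin n
  cells : List (Fin n × List (Fin n))
  opp_opp : ∀ d, opp (opp d) = d := by decide
  in_ne_out : inSide ≠ outSide := by decide
  opp_eq_iff : ∀ d, opp d = d ↔ inSide = d ∨ outSide = d := by decide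
  in_hit : ∃ m < n, (fun d => next (opp d))^[m] (next inSide) = inSide ∧
    ∀ l < m, opp ((fun d => next (opp d))^[l] (next inSide)) ≠
      (fun d => next (opp d))^[l] (next inSide) := by decide
  out_hit : ∃ m < n, (fun d => next (opp d))^[m] (next outSide) = outSide ∧
    ∀ l < m, opp ((fun d => next (opp d))^[l] (next outSide)) ≠
      (fun d => next (opp d))^[l] (next outSide) := by decide
  cells_cover : ∀ d, ∃ x ∈ cells, d ∈ x.1 :: x.2 := by decide
  cells_nodup : ∀ x ∈ cells, (x.1 :: x.2).Nodup := by decide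
  cells_iterate : ∀ x ∈ cells,
    (List.range (x.2.length + 1)).map (fun m => next^[m] x.1) = x.1 :: x.2 := by decide
  cells_closed : ∀ x ∈ cells, next^[x.2.length + 1] x.1 = x.1 := by decide

namespace Gluing

variable {n m : ℕ} {C : Type u} {P : Type v} [Group C] [Group P] [MulDistribMulAction P C]
  {X : CrossedModule C P} {g k : P}

/-! ### Cells of a gluing scheme -/

theorem mem_cell_iff (F : Gluing n) {x : Fin n × List (Fin n)} (hx : x ∈ F.cells) {d : Fin n} :
    d ∈ x.1 :: x.2 ↔ ∃ l < x.2.length + 1, F.next^[l] x.1 = d := by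
  rw [← F.cells_iterate x hx]
  simp only [List.mem_map, List.mem_range]

theorem next_mem_cell (F : Gluing n) {x : Fin n × List (Fin n)} (hx : x ∈ F.cells) {d : Fin n}
    (hd : d ∈ x.1 :: x.2) : F.next d ∈ x.1 :: x.2 := by
  obtain ⟨l, hl, rfl⟩ := (F.mem_cell_iff hx).1 hd
  rw [← Function.iterate_succ_apply' F.next l x.1]
  rcases Nat.lt_or_ge (l + 1) (x.2.length + 1) with h | h
  · exact (F.mem_cell_iff hx).2 ⟨l + 1, h, rfl⟩
  · rw [show l.succ = x.2.length + 1 by omega, F.cells_closed x hx]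
    exact List.mem_cons_self

theorem sameCycle_iff (F : Gluing n) (d e : Fin n) :
    F.next.SameCycle d e ↔ ∃ x ∈ F.cells, d ∈ x.1 :: x.2 ∧ e ∈ x.1 :: x.2 := by
  constructor
  · intro h
    obtain ⟨x, hx, hd⟩ := F.cells_cover d
    refine ⟨x, hx, hd, ?_⟩
    obtain ⟨i, rfl⟩ := h.exists_nat_pow_eq
    induction i with
    | zero => simpa using hd
    | succ i ih =>
      rw [pow_succ', Equiv.Perm.mul_apply]
      exact F.next_mem_cell hx (ih ⟨i, by simp⟩)
  · rintro ⟨x, hx, hd, he⟩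
    obtain ⟨a, -, rfl⟩ := (F.mem_cell_iff hx).1 hd
    obtain ⟨b, -, rfl⟩ := (F.mem_cell_iff hx).1 he
    rw [Equiv.Perm.iterate_eq_pow, Equiv.Perm.iterate_eq_pow]
    exact (Equiv.Perm.sameCycle_pow_left.2 (Equiv.Perm.sameCycle_pow_right.2 (.refl _ _)))

theorem minimalPeriod_cell (F : Gluing n) {x : Fin n × List (Fin n)} (hx : x ∈ F.cells) :
    Function.minimalPeriod F.next x.1 = x.2.length + 1 := by
  refine le_antisymm (Function.IsPeriodicPt.minimalPeriod_le (Nat.succ_pos _)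
    (F.cells_closed x hx)) ?_
  by_contra! h
  have h0 : 0 < Function.minimalPeriod F.next x.1 :=
    Function.minimalPeriod_pos_of_mem_periodicPts ⟨_, Nat.succ_pos _, F.cells_closed x hx⟩
  have hnd := F.cells_nodup x hx
  rw [← F.cells_iterate x hx] at hnd
  have := List.inj_on_of_nodup_map hnd (List.mem_range.2 h) (List.mem_range.2 (Nat.succ_pos _))
    (Function.isPeriodicPt_minimalPeriod F.next x.1)
  omega

/-- The boundary condition holds at every start vertex of a 2-cell once it holds at one of them. -/
theorem bd_c_next {α : Type} [Finite α] (next : Equiv.Perm α) (p : α → P) (c : α → C)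
    (c_next : ∀ d, c (next d) = (p d)⁻¹ • c d) (d : α)
    (h : X.bd (c d) = pathProd next p (Function.minimalPeriod next d) d) :
    X.bd (c (next d)) = pathProd next p (Function.minimalPeriod next (next d)) (next d) := by
  have hd : d ∈ Function.periodicPts next := next.injective.mem_periodicPts d
  rw [Function.minimalPeriod_apply hd, c_next, X.bd_smul, h]
  have key : ∀ N, p d * pathProd next p N (next d) = pathProd next p N d * p (next^[N] d) := by
    intro N
    induction N with
    | zero => simp [pathProd]
    | succ N ih =>
      have h1 : ∀ e, pathProd next p (N + 1) e = pathProd next p N e * p (next^[N] e) := by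
        intro e
        simp [pathProd, List.range_succ]
      rw [h1, h1, ← mul_assoc, ih, ← Function.iterate_succ_apply]
  have := key (Function.minimalPeriod next d)
  rw [Function.iterate_minimalPeriod] at this
  rw [inv_inv, mul_assoc, ← this, inv_mul_cancel_left]

/-! ### Labelled gluing schemes -/

/-- Labels of the edges and of the 2-cells of a gluing scheme, between circles labelled `g`
and `k`. The boundary condition is required for one start vertex of each 2-cell. -/
structure Labelling (F : Gluing n) (X : CrossedModule C P) (g k : P) where
  p : Fin n → P
  c : Fin n → C
  p_opp : ∀ d, F.opp d ≠ d → p (F.opp d) = (p d)⁻¹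
  p_in : p F.inSide = g⁻¹
  p_out : p F.outSide = k
  c_next : ∀ d, c (F.next d) = (p d)⁻¹ • c d
  bd_c : ∀ x ∈ F.cells, X.bd (c x.1) = ((x.1 :: x.2).map p).prod

theorem Labelling.bd_c_all {F : Gluing n} (a : Labelling F X g k) (d : Fin n) :
    X.bd (a.c d) = pathProd F.next a.p (Function.minimalPeriod F.next d) d := by
  obtain ⟨x, hx, hd⟩ := F.cells_cover d
  obtain ⟨l, -, rfl⟩ := (F.mem_cell_iff hx).1 hd
  clear hd
  induction l with
  | zero =>
    rw [Function.iterate_zero_apply, F.minimalPeriod_cell hx, a.bd_c x hx,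
      ← F.cells_iterate x hx, pathProd, List.map_map]
    rfl
  | succ l ih =>
    rw [Function.iterate_succ_apply']
    exact bd_c_next F.next a.p a.c a.c_next _ ih

/-- The formal cobordism of a labelled gluing scheme. -/
def Labelling.toCobordism {F : Gluing n} (a : Labelling F X g k) :
    FormalCobordism X (circle g) (circle k) where
  Side := Fin n
  finite_side := inferInstance
  next := F.next
  opp := F.opp
  opp_opp := F.opp_opp
  inBd := fun _ => F.inSide
  outBd := fun _ => F.outSide
  inBd_injective := fun _ _ _ => Subsingleton.elim _ _
  outBd_injective := fun _ _ _ => Subsingleton.elim _ _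
  inBd_ne_outBd := fun _ _ => F.in_ne_out
  opp_eq_iff := fun d => by simpa using F.opp_eq_iff d
  in_succ := fun _ => ⟨(F.opp_eq_iff _).2 (Or.inl rfl),
    F.in_hit.imp fun _ h => ⟨h.2.1, h.2.2⟩⟩
  out_succ := fun _ => ⟨(F.opp_eq_iff _).2 (Or.inr rfl),
    F.out_hit.imp fun _ h => ⟨h.2.1, h.2.2⟩⟩
  p := a.p
  p_opp := a.p_opp
  p_in := fun _ => a.p_in
  p_out := fun _ => a.p_out
  c := a.c
  c_next := a.c_next
  bd_c := a.bd_c_all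

/-! ### Elementary equivalences of labelled gluing schemes -/

/-- `F'` is the gluing scheme `F` with the interior edge `{d, F.opp d}` erased, where `j` sends the
sides of `F'` to the remaining sides of `F`. -/
structure Erases (F : Gluing n) (F' : Gluing m) (d : Fin n) (j : Fin m → Fin n) : Prop where
  interior : F.opp d ≠ d := by decide
  injective : ∀ x y, j x = j y → x = y := by decide
  range : ∀ x, (∃ y, j y = x) ↔ x ≠ d ∧ x ≠ F.opp d := by decide
  opp_comm : ∀ x, j (F'.opp x) = F.opp (j x) := by decide
  in_comm : j F'.inSide = F.inSide := by decide
  out_comm : j F'.outSide = F.outSide := by decide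
  next_comm : ∀ x, ∃ l < n, (fun y => F.next (F.opp y))^[l] (F.next (j x)) = j (F'.next x) ∧
    ∀ i < l, ¬ ((fun y => F.next (F.opp y))^[i] (F.next (j x)) ≠ d ∧
      (fun y => F.next (F.opp y))^[i] (F.next (j x)) ≠ F.opp d) := by decide

theorem Erases.isErasure {F : Gluing n} {F' : Gluing m} {d : Fin n} {j : Fin m → Fin n}
    (h : Erases F F' d j) (a : Labelling F X g k) (a' : Labelling F' X g k)
    (hp : ∀ x, a'.p x = a.p (j x)) : IsErasure a.toCobordism a'.toCobordism d j where
  interior := h.interior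
  injective := fun x y => h.injective x y
  range := h.range
  opp_comm := h.opp_comm
  inBd_comm := fun _ => h.in_comm
  outBd_comm := fun _ => h.out_comm
  p_comm := hp
  next_comm := fun x => ⟨(h.range _).1 ⟨_, rfl⟩,
    (h.next_comm x).imp fun _ h => ⟨h.2.1, h.2.2⟩⟩

/-- Combining two 2-cells of a labelled gluing scheme; `y` is the side after the erased edge. -/
theorem Erases.combine {F : Gluing n} {F' : Gluing m} {d : Fin n} {j : Fin m → Fin n}
    (h : Erases F F' d j) (a : Labelling F X g k) (a' : Labelling F' X g k)
    (hcell : ¬ ∃ x ∈ F.cells, d ∈ x.1 :: x.2 ∧ F.opp d ∈ x.1 :: x.2) (y : Fin m)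
    (hy : j y = F.next d) (hp : ∀ x, a'.p x = a.p (j x))
    (hother : ∀ x, (¬ ∃ z ∈ F.cells, d ∈ z.1 :: z.2 ∧ j x ∈ z.1 :: z.2) →
      (¬ ∃ z ∈ F.cells, F.opp d ∈ z.1 :: z.2 ∧ j x ∈ z.1 :: z.2) → a'.c x = a.c (j x))
    (hnew : a'.c y = a.c (F.next d) * a.c (F.opp d)) :
    a.toCobordism.Equivalent a'.toCobordism := by
  refine .rel _ _ (.combine _ _ d j (h.isErasure a a' hp) ?_ ?_ ?_ ?_)
  · exact fun hs => hcell ((F.sameCycle_iff _ _).1 hs)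
  · exact fun hd => ((h.range _).1 ⟨y, hy⟩).1 hd
  · exact fun x h1 h2 => hother x (fun hx => h1 ((F.sameCycle_iff _ _).2 hx))
      (fun hx => h2 ((F.sameCycle_iff _ _).2 hx))
  · intro x hx
    obtain rfl : x = y := h.injective _ _ (hx.trans hy.symm)
    exact hnew

/-- Absorbing an edge with a free end into a 2-cell of a labelled gluing scheme. -/
theorem Erases.absorb {F : Gluing n} {F' : Gluing m} {d : Fin n} {j : Fin m → Fin n}
    (h : Erases F F' d j) (a : Labelling F X g k) (a' : Labelling F' X g k)
    (hspur : F.next d = F.opp d) (hd : F.next (F.opp d) ≠ d) (hp : ∀ x, a'.p x = a.p (j x))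
    (hc : ∀ x, a'.c x = a.c (j x)) : a.toCobordism.Equivalent a'.toCobordism :=
  .rel _ _ (.absorb _ _ d j (h.isErasure a a' hp) hspur hd hc)

end Gluing

/-! ### The annulus cut open along a path -/

/-- The label of a 2-cell is fixed by its boundary, by the Peiffer identity. Hence moving the start
vertex of an annulus `(Cyl; c, g, 1)` along its outgoing circle, labelled `k`, acts on `c` as
`g⁻¹`. -/
theorem CrossedModule.inv_smul_eq_of_eq_bd_mul {C : Type u} {P : Type v} [Group C] [Group P]
    [MulDistribMulAction P C] (X : CrossedModule C P) {c : C} {g k : P} (hk : k = X.bd c * g) :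
    k⁻¹ • c = g⁻¹ • c := by
  rw [hk, mul_inv_rev, mul_smul, ← map_inv, X.peiffer]
  simp

namespace Gluing

variable {C : Type u} {P : Type v} [Group C] [Group P] [MulDistribMulAction P C]

/-- The annulus with one 2-cell, cut open along one edge. The outgoing circle is the side `0`, the
incoming one the side `2`. -/
def single : Gluing 4 where
  next := Equiv.addRight 1
  opp := ![0, 3, 2, 1]
  inSide := 2
  outSide := 0
  cells := [(0, [1, 2, 3])]

/-- The labels of the annulus `(Cyl; c, g, 1)`. -/
def singleLabels (X : CrossedModule C P) (c : C) (g k : P) (hk : k = X.bd c * g) :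
    Labelling single X g k where
  p := ![k, 1, g⁻¹, 1]
  c := ![c, g⁻¹ • c, g⁻¹ • c, c]
  p_opp := fun d hd => by fin_cases d <;> simp [single] at hd ⊢
  p_in := rfl
  p_out := rfl
  c_next := fun d => by
    have h : k⁻¹ • c = g⁻¹ • c := X.inv_smul_eq_of_eq_bd_mul hk
    fin_cases d <;> simp [single, h]
  bd_c := by simp [single, hk]

/-- The annulus cut open along one edge `{1, 5}`, with a second edge `{3, 4}` that leads from the
base point of the incoming circle to a free vertex inside the 2-cell. -/
def spur : Gluing 6 where
  next := Equiv.addRight 1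
  opp := ![0, 5, 2, 4, 3, 1]
  inSide := 2
  outSide := 0
  cells := [(0, [1, 2, 3, 4, 5])]

/-- The labels of `(Cyl; c, g, 1)`, with `1` on the additional edge. -/
def spurLabels (X : CrossedModule C P) (c : C) (g k : P) (hk : k = X.bd c * g) :
    Labelling spur X g k where
  p := ![k, 1, g⁻¹, 1, 1, 1]
  c := ![c, g⁻¹ • c, g⁻¹ • c, c, c, c]
  p_opp := fun d hd => by fin_cases d <;> simp [spur] at hd ⊢
  p_in := rfl
  p_out := rfl
  c_next := fun d => by
    have h : k⁻¹ • c = g⁻¹ • c := X.inv_smul_eq_of_eq_bd_mul hk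
    fin_cases d <;> simp [spur, h]
  bd_c := by simp [spur, hk]

theorem spur_equivalent (X : CrossedModule C P) (c : C) (g k : P)
    (hk : k = X.bd c * g) :
    (spurLabels X c g k hk).toCobordism.Equivalent
      (singleLabels X c g k hk).toCobordism := by
  have h : Erases spur single 3 ![0, 1, 2, 5] := {}
  exact h.absorb _ _ (by decide) (by decide) (fun x => by fin_cases x <;> rfl)
    (fun x => by fin_cases x <;> rfl)

/-- The annulus with one 2-cell, cut open along a path of two edges `{1, 5}`, `{2, 4}`. -/
def pathTwo : Gluing 6 where
  next := Equiv.addRight 1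
  opp := ![0, 5, 4, 3, 2, 1]
  inSide := 3
  outSide := 0
  cells := [(0, [1, 2, 3, 4, 5])]

/-- The labels with `1` on the path and `c` on the 2-cell. -/
def pathTwoLabels (X : CrossedModule C P) (c : C) (g k : P) (hk : k = X.bd c * g) :
    Labelling pathTwo X g k where
  p := ![k, 1, 1, g⁻¹, 1, 1]
  c := ![c, g⁻¹ • c, g⁻¹ • c, g⁻¹ • c, c, c]
  p_opp := fun d hd => by fin_cases d <;> simp [pathTwo] at hd ⊢
  p_in := rfl
  p_out := rfl
  c_next := fun d => by
    have h : k⁻¹ • c = g⁻¹ • c := X.inv_smul_eq_of_eq_bd_mul hk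
    fin_cases d <;> simp [pathTwo, h]
  bd_c := by simp [pathTwo, hk]

/-- `pathTwo` with a chord `{6, 7}` parallel to the path, which cuts off a triangle. -/
def pathTwoSplit : Gluing 8 where
  next := ⟨![6, 2, 7, 4, 5, 0, 3, 1], ![5, 7, 1, 6, 3, 4, 0, 2], by decide, by decide⟩
  opp := ![0, 5, 4, 3, 2, 1, 7, 6]
  inSide := 3
  outSide := 0
  cells := [(0, [6, 3, 4, 5]), (1, [2, 7])]

/-- The labels with `1` on the path, the chord and the triangle. -/
def pathTwoSplitLabels (X : CrossedModule C P) (c : C) (g k : P) (hk : k = X.bd c * g) :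
    Labelling pathTwoSplit X g k where
  p := ![k, 1, 1, g⁻¹, 1, 1, 1, 1]
  c := ![c, 1, 1, g⁻¹ • c, c, c, g⁻¹ • c, 1]
  p_opp := fun d hd => by fin_cases d <;> simp [pathTwoSplit] at hd ⊢
  p_in := rfl
  p_out := rfl
  c_next := fun d => by
    have h : k⁻¹ • c = g⁻¹ • c := X.inv_smul_eq_of_eq_bd_mul hk
    fin_cases d <;> simp [pathTwoSplit, h]
  bd_c := by simp [pathTwoSplit, hk]

/-- Erasing the chord. -/
theorem pathTwoSplit_equivalent (X : CrossedModule C P) (c : C) (g k : P)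
    (hk : k = X.bd c * g) :
    (pathTwoSplitLabels X c g k hk).toCobordism.Equivalent
      (pathTwoLabels X c g k hk).toCobordism := by
  have h : Erases pathTwoSplit pathTwo 6 ![0, 1, 2, 3, 4, 5] := {}
  refine h.combine _ _ (by decide) 3 (by decide) (fun x => by fin_cases x <;> rfl)
    (fun x h1 h2 => ?_) (mul_one _).symm
  fin_cases x <;> first | rfl | exact absurd (by decide) h1 | exact absurd (by decide) h2

/-- Erasing the edge of the path at the outgoing circle: the chord takes the place of the path. -/
theorem pathTwoSplit_equivalent_spur (X : CrossedModule C P) (c : C) (g k : P)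
    (hk : k = X.bd c * g) :
    (pathTwoSplitLabels X c g k hk).toCobordism.Equivalent
      (spurLabels X c g k hk).toCobordism := by
  have h : Erases pathTwoSplit spur 5 ![0, 6, 3, 4, 2, 7] := {}
  refine h.combine _ _ (by decide) 0 (by decide) (fun x => by fin_cases x <;> rfl)
    (fun x h1 h2 => ?_) (mul_one _).symm
  fin_cases x <;> first | rfl | exact absurd (by decide) h1 | exact absurd (by decide) h2

/-- The annulus cut open along one edge `{1, 7}`, with a path of two edges `{3, 6}`, `{4, 5}` that
leads from the base point of the incoming circle to a free vertex inside the 2-cell. -/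
def twoSpurs : Gluing 8 where
  next := Equiv.addRight 1
  opp := ![0, 7, 2, 6, 5, 4, 3, 1]
  inSide := 2
  outSide := 0
  cells := [(0, [1, 2, 3, 4, 5, 6, 7])]

/-- The labels of `(Cyl; c, g, 1)`, with `1` on the additional edges. -/
def twoSpursLabels (X : CrossedModule C P) (c : C) (g k : P) (hk : k = X.bd c * g) :
    Labelling twoSpurs X g k where
  p := ![k, 1, g⁻¹, 1, 1, 1, 1, 1]
  c := ![c, g⁻¹ • c, g⁻¹ • c, c, c, c, c, c]
  p_opp := fun d hd => by fin_cases d <;> simp [twoSpurs] at hd ⊢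
  p_in := rfl
  p_out := rfl
  c_next := fun d => by
    have h : k⁻¹ • c = g⁻¹ • c := X.inv_smul_eq_of_eq_bd_mul hk
    fin_cases d <;> simp [twoSpurs, h]
  bd_c := by simp [twoSpurs, hk]

theorem twoSpurs_equivalent (X : CrossedModule C P) (c : C) (g k : P)
    (hk : k = X.bd c * g) :
    (twoSpursLabels X c g k hk).toCobordism.Equivalent
      (spurLabels X c g k hk).toCobordism := by
  have h : Erases twoSpurs spur 4 ![0, 1, 2, 3, 6, 7] := {}
  exact h.absorb _ _ (by decide) (by decide) (fun x => by fin_cases x <;> rfl)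
    (fun x => by fin_cases x <;> rfl)

/-- The annulus cut open along a path of three edges `{1, 7}`, `{2, 6}`, `{3, 5}`. -/
def pathThree : Gluing 8 where
  next := Equiv.addRight 1
  opp := ![0, 7, 6, 5, 4, 3, 2, 1]
  inSide := 4
  outSide := 0
  cells := [(0, [1, 2, 3, 4, 5, 6, 7])]

/-- The labels with `1` on the path and `c` on the 2-cell. -/
def pathThreeLabels (X : CrossedModule C P) (c : C) (g k : P) (hk : k = X.bd c * g) :
    Labelling pathThree X g k where
  p := ![k, 1, 1, 1, g⁻¹, 1, 1, 1]
  c := ![c, g⁻¹ • c, g⁻¹ • c, g⁻¹ • c, g⁻¹ • c, c, c, c]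
  p_opp := fun d hd => by fin_cases d <;> simp [pathThree] at hd ⊢
  p_in := rfl
  p_out := rfl
  c_next := fun d => by
    have h : k⁻¹ • c = g⁻¹ • c := X.inv_smul_eq_of_eq_bd_mul hk
    fin_cases d <;> simp [pathThree, h]
  bd_c := by simp [pathThree, hk]

/-- `pathThree` with a chord `{8, 9}` parallel to the path, which cuts off a quadrangle. -/
def pathThreeSplit : Gluing 10 where
  next :=
    ⟨![8, 2, 3, 9, 5, 6, 7, 0, 4, 1],
      ![7, 9, 1, 2, 8, 4, 5, 6, 0, 3],
      by decide, by decide⟩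
  opp := ![0, 7, 6, 5, 4, 3, 2, 1, 9, 8]
  inSide := 4
  outSide := 0
  cells := [(0, [8, 4, 5, 6, 7]), (1, [2, 3, 9])]

/-- The labels with `1` on the path, the chord and the quadrangle. -/
def pathThreeSplitLabels (X : CrossedModule C P) (c : C) (g k : P) (hk : k = X.bd c * g) :
    Labelling pathThreeSplit X g k where
  p := ![k, 1, 1, 1, g⁻¹, 1, 1, 1, 1, 1]
  c := ![c, 1, 1, 1, g⁻¹ • c, c, c, c, g⁻¹ • c, 1]
  p_opp := fun d hd => by fin_cases d <;> simp [pathThreeSplit] at hd ⊢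
  p_in := rfl
  p_out := rfl
  c_next := fun d => by
    have h : k⁻¹ • c = g⁻¹ • c := X.inv_smul_eq_of_eq_bd_mul hk
    fin_cases d <;> simp [pathThreeSplit, h]
  bd_c := by simp [pathThreeSplit, hk]

/-- Erasing the chord. -/
theorem pathThreeSplit_equivalent (X : CrossedModule C P) (c : C) (g k : P)
    (hk : k = X.bd c * g) :
    (pathThreeSplitLabels X c g k hk).toCobordism.Equivalent
      (pathThreeLabels X c g k hk).toCobordism := by
  have h : Erases pathThreeSplit pathThree 8 ![0, 1, 2, 3, 4, 5, 6, 7] := {}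
  refine h.combine _ _ (by decide) 4 (by decide) (fun x => by fin_cases x <;> rfl)
    (fun x h1 h2 => ?_) (mul_one _).symm
  fin_cases x <;> first | rfl | exact absurd (by decide) h1 | exact absurd (by decide) h2

/-- Erasing the edge of the path at the outgoing circle: the chord takes the place of the path. -/
theorem pathThreeSplit_equivalent_twoSpurs (X : CrossedModule C P) (c : C) (g k : P)
    (hk : k = X.bd c * g) :
    (pathThreeSplitLabels X c g k hk).toCobordism.Equivalent
      (twoSpursLabels X c g k hk).toCobordism := by
  have h : Erases pathThreeSplit twoSpurs 7 ![0, 8, 4, 5, 6, 2, 3, 9] := {}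
  refine h.combine _ _ (by decide) 0 (by decide) (fun x => by fin_cases x <;> rfl)
    (fun x h1 h2 => ?_) (mul_one _).symm
  fin_cases x <;> first | rfl | exact absurd (by decide) h1 | exact absurd (by decide) h2

theorem single_equivalent_annulus (X : CrossedModule C P) (c : C) (g k : P) (hk : k = X.bd c * g)
    (hk' : k = X.bd c * (1⁻¹ * g * 1)) :
    (singleLabels X c g k hk).toCobordism.Equivalent (annulus X c g 1 k hk') := by
  have h : k⁻¹ • c = g⁻¹ • c := X.inv_smul_eq_of_eq_bd_mul hk
  refine .rel _ _ (.iso _ _ (Equiv.refl (Fin 4)) ⟨fun _ => rfl, fun _ => rfl, fun _ => rfl,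
    fun _ => rfl, ?_, ?_⟩)
  · intro d
    change (![k, 1⁻¹, g⁻¹, 1] : Fin 4 → P) d = (![k, 1, g⁻¹, 1] : Fin 4 → P) d
    rw [inv_one]
  · intro d
    change (![c, k⁻¹ • c, (1 * k⁻¹) • c, (g * 1 * k⁻¹) • c] : Fin 4 → C) d =
      (![c, g⁻¹ • c, g⁻¹ • c, c] : Fin 4 → C) d
    rw [one_mul, mul_one, mul_smul, h, smul_inv_smul]

/-! ### Composition of annuli -/

/-- Two annuli on top of each other, glued along the circle `{0, 6}`. -/
def twoAnnuli : Gluing 8 where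
  next := ⟨![1, 2, 3, 0, 5, 6, 7, 4], ![3, 0, 1, 2, 7, 4, 5, 6], by decide, by decide⟩
  opp := ![6, 3, 2, 1, 4, 7, 0, 5]
  inSide := 2
  outSide := 4
  cells := [(0, [1, 2, 3]), (4, [5, 6, 7])]

/-- The labels of `(Cyl; c, g, 1)` followed by `(Cyl; c', k, 1)`. -/
def twoAnnuliLabels (X : CrossedModule C P) (c c' : C) (g k k' : P)
    (hk : k = X.bd c * g) (hk' : k' = X.bd c' * k) :
    Labelling twoAnnuli X g k' where
  p := ![k, 1, g⁻¹, 1, k', 1, k⁻¹, 1]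
  c := ![c, g⁻¹ • c, g⁻¹ • c, c, c', k⁻¹ • c', k⁻¹ • c', c']
  p_opp := fun d hd => by fin_cases d <;> simp [twoAnnuli] at hd ⊢
  p_in := rfl
  p_out := rfl
  c_next := fun d => by
    have h : k⁻¹ • c = g⁻¹ • c := X.inv_smul_eq_of_eq_bd_mul hk
    have h' : k'⁻¹ • c' = k⁻¹ • c' := X.inv_smul_eq_of_eq_bd_mul hk'
    fin_cases d <;> simp [twoAnnuli, h, h']
  bd_c := by simp [twoAnnuli, hk, hk', mul_assoc]

/-- Erasing the common circle multiplies the labels of the 2-cells. -/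
theorem twoAnnuli_equivalent (X : CrossedModule C P) (c c' : C) (g k k' : P)
    (hk : k = X.bd c * g) (hk' : k' = X.bd c' * k) (hk'' : k' = X.bd (c' * c) * g) :
    (twoAnnuliLabels X c c' g k k' hk hk').toCobordism.Equivalent
      (pathTwoLabels X (c' * c) g k' hk'').toCobordism := by
  have h : Erases twoAnnuli pathTwo 6 ![4, 5, 1, 2, 3, 7] := {}
  refine h.combine _ _ (by decide) 5 (by decide) (fun x => by fin_cases x <;> rfl)
    (fun x h1 h2 => ?_) rfl
  fin_cases x <;> first | rfl | exact absurd (by decide) h1 | exact absurd (by decide) h2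

theorem cylinder_circle_opp (X : CrossedModule C P) (g : P) {T : FormalOneManifold P}
    (φ : Iso (circle g) T) (e : (circle g).Edge) (i : Fin 4) :
    (cylinder X φ).opp ((e, i) : (circle g).Edge × Fin 4) =
      ((e, (![0, 3, 2, 1] : Fin 4 → Fin 4) i) : (circle g).Edge × Fin 4) := by
  fin_cases i
  · rfl
  · exact Prod.ext (Subsingleton.elim _ _) rfl
  · rfl
  · exact Prod.ext (Subsingleton.elim _ _) rfl

theorem annulus_one_equivalent_identity (X : CrossedModule C P) (g : P)
    (hk : g = X.bd 1 * (1⁻¹ * g * 1)) :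
    (annulus X 1 g 1 g hk).Equivalent (identity X (circle g)) := by
  refine .rel _ _ (.iso _ _ (Equiv.uniqueProd (Fin 4) (circle g).Edge).symm
    ⟨fun _ => rfl, fun d => (cylinder_circle_opp X g _ default d).symm, ?_, ?_, ?_, ?_⟩)
  · intro e
    rw [Subsingleton.elim e default]
    rfl
  · intro e
    rw [Subsingleton.elim e default]
    rfl
  · intro d
    change (![g, 1, g⁻¹, 1] : Fin 4 → P) d = (![g, 1⁻¹, g⁻¹, 1] : Fin 4 → P) d
    rw [inv_one]
  · intro d
    change (1 : C) = (![1, g⁻¹ • 1, (1 * g⁻¹) • 1, (g * 1 * g⁻¹) • 1] : Fin 4 → C) d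
    change Fin 4 at d
    fin_cases d <;> simp

/-- The sides of two squares in the order used by `twoAnnuli`. -/
def twoAnnuliSide : Fin 8 ≃ Fin 4 ⊕ Fin 4 where
  toFun := ![.inl 0, .inl 1, .inl 2, .inl 3, .inr 0, .inr 1, .inr 2, .inr 3]
  invFun := Sum.elim ![0, 1, 2, 3] ![4, 5, 6, 7]
  left_inv := by decide
  right_inv := by decide

theorem twoAnnuli_equivalent_comp (X : CrossedModule C P) (c c' : C) (g k k' : P)
    (hk : k = X.bd c * g) (hk' : k' = X.bd c' * k) (h1 : k = X.bd c * (1⁻¹ * g * 1))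
    (h2 : k' = X.bd c' * (1⁻¹ * k * 1)) :
    (twoAnnuliLabels X c c' g k k' hk hk').toCobordism.Equivalent
      ((annulus X c g 1 k h1).comp (annulus X c' k 1 k' h2)) := by
  have h : k⁻¹ • c = g⁻¹ • c := X.inv_smul_eq_of_eq_bd_mul hk
  have h' : k'⁻¹ • c' = k⁻¹ • c' := X.inv_smul_eq_of_eq_bd_mul hk'
  refine .rel _ _ (.iso _ _ twoAnnuliSide
    ⟨?_, ?_, fun _ => rfl, fun _ => rfl, ?_, ?_⟩)
  · intro d
    change Fin 8 at d
    fin_cases d <;> rfl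
  · intro d
    change Fin 8 at d
    have hF : ∀ d : Fin 4, d ≠ 0 →
        compOpp (annulus X c g 1 k h1) (annulus X c' k 1 k' h2) (Sum.inl d) =
          Sum.inl ((![0, 3, 2, 1] : Fin 4 → Fin 4) d) :=
      fun d hd => compOpp_inl (annulus X c g 1 k h1) _ d fun _ => hd.symm
    have hG : ∀ d : Fin 4, d ≠ 2 →
        compOpp (annulus X c g 1 k h1) (annulus X c' k 1 k' h2) (Sum.inr d) =
          Sum.inr ((![0, 3, 2, 1] : Fin 4 → Fin 4) d) :=
      fun d hd => compOpp_inr _ (annulus X c' k 1 k' h2) d fun _ => hd.symm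
    fin_cases d
    · exact (compOpp_outBd (annulus X c g 1 k h1) (annulus X c' k 1 k' h2) default).symm
    · exact (hF 1 (by decide)).symm
    · exact (hF 2 (by decide)).symm
    · exact (hF 3 (by decide)).symm
    · exact (hG 0 (by decide)).symm
    · exact (hG 1 (by decide)).symm
    · exact (compOpp_inBd (annulus X c g 1 k h1) (annulus X c' k 1 k' h2) default).symm
    · exact (hG 3 (by decide)).symm
  · intro d
    change Fin 8 at d
    fin_cases d <;> first | rfl | exact inv_one
  · intro d
    change Fin 8 at d
    fin_cases d
    · rfl
    · exact h
    · change (1 * k⁻¹) • c = g⁻¹ • c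
      rw [one_mul, h]
    · change (g * 1 * k⁻¹) • c = c
      rw [mul_one, mul_smul, h, smul_inv_smul]
    · rfl
    · exact h'
    · change (1 * k'⁻¹) • c' = k⁻¹ • c'
      rw [one_mul, h']
    · change (k * 1 * k'⁻¹) • c' = c'
      rw [mul_one, mul_smul, h', smul_inv_smul]

/-- The composite of two annuli is an annulus, and the labels of the 2-cells multiply. -/
theorem annulus_comp_equivalent (X : CrossedModule C P) (c c' : C) (g k k' : P)
    (h1 : k = X.bd c * (1⁻¹ * g * 1)) (h2 : k' = X.bd c' * (1⁻¹ * k * 1))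
    (h3 : k' = X.bd (c' * c) * (1⁻¹ * g * 1)) :
    ((annulus X c g 1 k h1).comp (annulus X c' k 1 k' h2)).Equivalent
      (annulus X (c' * c) g 1 k' h3) := by
  have hk : k = X.bd c * g := by simpa using h1
  have hk' : k' = X.bd c' * k := by simpa using h2
  have hk'' : k' = X.bd (c' * c) * g := by simpa using h3
  exact (twoAnnuli_equivalent_comp X c c' g k k' hk hk' h1 h2).symm
    |>.trans _ _ _ (twoAnnuli_equivalent X c c' g k k' hk hk' hk'')
    |>.trans _ _ _ (pathTwoSplit_equivalent X _ g k' hk'').symm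
    |>.trans _ _ _ (pathTwoSplit_equivalent_spur X _ g k' hk'')
    |>.trans _ _ _ (spur_equivalent X _ g k' hk'')
    |>.trans _ _ _ (single_equivalent_annulus X _ g k' hk'' h3)

/-! ### Filling a hole of the disc with two holes -/

/-- Three annuli on top of each other, glued along the circles `{0, 6}` and `{4, 10}`. -/
def threeAnnuli : Gluing 12 where
  next :=
    ⟨![1, 2, 3, 0, 5, 6, 7, 4, 9, 10, 11, 8],
      ![3, 0, 1, 2, 7, 4, 5, 6, 11, 8, 9, 10],
      by decide, by decide⟩
  opp := ![6, 3, 2, 1, 10, 7, 0, 5, 8, 11, 4, 9]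
  inSide := 2
  outSide := 8
  cells := [(0, [1, 2, 3]), (4, [5, 6, 7]), (8, [9, 10, 11])]

/-- The labels with `1` on the vertical edges and the two inner annuli, and `c` on the outer one. -/
def threeAnnuliLabels (X : CrossedModule C P) (c : C) (g k : P) (hk : k = X.bd c * g) :
    Labelling threeAnnuli X g k where
  p := ![g, 1, g⁻¹, 1, g, 1, g⁻¹, 1, k, 1, g⁻¹, 1]
  c := ![1, 1, 1, 1, 1, 1, 1, 1, c, g⁻¹ • c, g⁻¹ • c, c]
  p_opp := fun d hd => by fin_cases d <;> simp [threeAnnuli] at hd ⊢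
  p_in := rfl
  p_out := rfl
  c_next := fun d => by
    have h : k⁻¹ • c = g⁻¹ • c := X.inv_smul_eq_of_eq_bd_mul hk
    fin_cases d <;> simp [threeAnnuli, h]
  bd_c := by simp [threeAnnuli, hk]

/-- Two annuli on top of each other, glued along the circle `{0, 5}`; the outer one is cut open
along a path of two edges `{4, 6}`, `{8, 9}`. -/
def longAndShort : Gluing 10 where
  next :=
    ⟨![1, 2, 3, 0, 5, 6, 9, 8, 4, 7],
      ![3, 0, 1, 2, 8, 4, 5, 9, 7, 6],
      by decide, by decide⟩
  opp := ![5, 3, 2, 1, 6, 0, 4, 7, 9, 8]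
  inSide := 2
  outSide := 7
  cells := [(0, [1, 2, 3]), (4, [5, 6, 9, 7, 8])]

/-- The labels with `1` on all vertical edges and on the inner annulus, and `c` on the outer one. -/
def longAndShortLabels (X : CrossedModule C P) (c : C) (g k : P) (hk : k = X.bd c * g) :
    Labelling longAndShort X g k where
  p := ![g, 1, g⁻¹, 1, 1, g⁻¹, 1, k, 1, 1]
  c := ![1, 1, 1, 1, g⁻¹ • c, g⁻¹ • c, c, c, g⁻¹ • c, c]
  p_opp := fun d hd => by fin_cases d <;> simp [longAndShort] at hd ⊢
  p_in := rfl
  p_out := rfl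
  c_next := fun d => by
    have h : k⁻¹ • c = g⁻¹ • c := X.inv_smul_eq_of_eq_bd_mul hk
    fin_cases d <;> simp [longAndShort, h]
  bd_c := by simp [longAndShort, X.bd_smul, hk, mul_assoc]

/-- Erasing the remaining inner circle. -/
theorem longAndShort_equivalent (X : CrossedModule C P) (c : C) (g k : P)
    (hk : k = X.bd c * g) :
    (longAndShortLabels X c g k hk).toCobordism.Equivalent
      (pathThreeLabels X c g k hk).toCobordism := by
  have h : Erases longAndShort pathThree 5 ![7, 8, 4, 1, 2, 3, 6, 9] := {}
  refine h.combine _ _ (by decide) 6 (by decide) (fun x => by fin_cases x <;> rfl)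
    (fun x h1 h2 => ?_) (mul_one _).symm
  fin_cases x <;> first | rfl | exact absurd (by decide) h1 | exact absurd (by decide) h2

/-- Erasing the circle between the two outer annuli. -/
theorem threeAnnuli_equivalent (X : CrossedModule C P) (c : C) (g k : P)
    (hk : k = X.bd c * g) :
    (threeAnnuliLabels X c g k hk).toCobordism.Equivalent
      (longAndShortLabels X c g k hk).toCobordism := by
  have h : Erases threeAnnuli longAndShort 10 ![0, 1, 2, 3, 5, 6, 7, 8, 9, 11] := {}
  refine h.combine _ _ (by decide) 9 (by decide) (fun x => by fin_cases x <;> rfl)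
    (fun x h1 h2 => ?_) (mul_one _).symm
  fin_cases x <;> first | rfl | exact absurd (by decide) h1 | exact absurd (by decide) h2

/-- `threeAnnuli` with an edge `{12, 13}` that leads from the base point of the outgoing circle to a
free vertex inside the outer annulus. -/
def threeAnnuliSpur : Gluing 14 where
  next :=
    ⟨![1, 2, 3, 0, 5, 6, 7, 4, 9, 10, 11, 12, 13, 8],
      ![3, 0, 1, 2, 7, 4, 5, 6, 13, 8, 9, 10, 11, 12],
      by decide, by decide⟩
  opp := ![6, 3, 2, 1, 10, 7, 0, 5, 8, 11, 4, 9, 13, 12]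
  inSide := 2
  outSide := 8
  cells := [(0, [1, 2, 3]), (4, [5, 6, 7]), (8, [9, 10, 11, 12, 13])]

/-- The labels of `threeAnnuli`, with `1` on the additional edge. -/
def threeAnnuliSpurLabels (X : CrossedModule C P) (c : C) (g k : P) (hk : k = X.bd c * g) :
    Labelling threeAnnuliSpur X g k where
  p := ![g, 1, g⁻¹, 1, g, 1, g⁻¹, 1, k, 1, g⁻¹, 1, 1, 1]
  c := ![1, 1, 1, 1, 1, 1, 1, 1, c, g⁻¹ • c, g⁻¹ • c, c, c, c]
  p_opp := fun d hd => by fin_cases d <;> simp [threeAnnuliSpur] at hd ⊢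
  p_in := rfl
  p_out := rfl
  c_next := fun d => by
    have h : k⁻¹ • c = g⁻¹ • c := X.inv_smul_eq_of_eq_bd_mul hk
    fin_cases d <;> simp [threeAnnuliSpur, h]
  bd_c := by simp [threeAnnuliSpur, hk]

theorem threeAnnuliSpur_equivalent (X : CrossedModule C P) (c : C) (g k : P)
    (hk : k = X.bd c * g) :
    (threeAnnuliSpurLabels X c g k hk).toCobordism.Equivalent
      (threeAnnuliLabels X c g k hk).toCobordism := by
  have h : Erases threeAnnuliSpur threeAnnuli 12 ![0, 1, 2, 3, 4, 5, 6, 7, 8, 9, 10, 11] := {}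
  exact h.absorb _ _ (by decide) (by decide) (fun x => by fin_cases x <;> rfl)
    (fun x => by fin_cases x <;> rfl)

/-- A disc with two holes (sides `9` to `15`), whose first hole is filled by a disc (side `4`) and
whose second one by two annuli on top of each other (sides `0` to `3` and `5` to `8`). -/
def cappedPants : Gluing 16 where
  next :=
    ⟨![1, 2, 3, 0, 4, 6, 7, 8, 5, 10, 11, 12, 13, 14, 15, 9],
      ![3, 0, 1, 2, 4, 8, 5, 6, 7, 15, 9, 10, 11, 12, 13, 14],
      by decide, by decide⟩
  opp := ![7, 3, 2, 1, 14, 11, 8, 0, 6, 9, 12, 5, 10, 15, 4, 13]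
  inSide := 2
  outSide := 9
  cells := [(0, [1, 2, 3]), (4, []), (5, [6, 7, 8]), (9, [10, 11, 12, 13, 14, 15])]

/-- The labels with `c` on the filling disc and `1` on the other 2-cells. -/
def cappedPantsLabels (X : CrossedModule C P) (c : C) (g k : P) (hk : k = X.bd c * g) :
    Labelling cappedPants X g k where
  p := ![g, 1, g⁻¹, 1, X.bd c, g, 1, g⁻¹, 1, k, 1, g⁻¹, 1, 1, (X.bd c)⁻¹, 1]
  c := ![1, 1, 1, 1, c, 1, 1, 1, 1, 1, 1, 1, 1, 1, 1, 1]
  p_opp := fun d hd => by fin_cases d <;> simp [cappedPants] at hd ⊢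
  p_in := rfl
  p_out := rfl
  c_next := fun d => by
    fin_cases d <;> simp [cappedPants, ← map_inv, X.peiffer]
  bd_c := by simp [cappedPants, hk]

/-- Erasing the boundary of the filling disc, whose label passes to the disc with two holes. -/
theorem cappedPants_equivalent (X : CrossedModule C P) (c : C) (g k : P)
    (hk : k = X.bd c * g) :
    (cappedPantsLabels X c g k hk).toCobordism.Equivalent
      (threeAnnuliSpurLabels X c g k hk).toCobordism := by
  have h : Erases cappedPants threeAnnuliSpur 14
      ![0, 1, 2, 3, 5, 6, 7, 8, 9, 10, 11, 12, 13, 15] := {}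
  refine h.combine _ _ (by decide) 13 (by decide) (fun x => by fin_cases x <;> rfl)
    (fun x h1 h2 => ?_) (one_mul _).symm
  fin_cases x <;> first | rfl | exact absurd (by decide) h1

/-- The sides of the composite of the cylinder of `(g) ≅ ∅ ⊔ (g)`, the union of a disc and a
cylinder, and the disc with two holes, in the order used by `cappedPants`. -/
def cappedPantsSide (g : P) : Fin 16 ≃
    ((circle g).Edge × Fin 4 ⊕ (Fin 1 ⊕ (circle g).Edge × Fin 4)) ⊕ Fin 7 where
  toFun := ![.inl (.inl (default, 0)), .inl (.inl (default, 1)), .inl (.inl (default, 2)),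
    .inl (.inl (default, 3)), .inl (.inr (.inl 0)), .inl (.inr (.inr (default, 0))),
    .inl (.inr (.inr (default, 1))), .inl (.inr (.inr (default, 2))),
    .inl (.inr (.inr (default, 3))), .inr 0, .inr 1, .inr 2, .inr 3, .inr 4, .inr 5, .inr 6]
  invFun := Sum.elim
    (Sum.elim (fun x => ![0, 1, 2, 3] x.2) (Sum.elim (fun _ => 4) fun x => ![5, 6, 7, 8] x.2))
    ![9, 10, 11, 12, 13, 14, 15]
  left_inv := fun d => by fin_cases d <;> rfl
  right_inv := by
    rintro ((⟨e, i⟩ | i | ⟨e, i⟩) | i) <;> (try rw [Subsingleton.elim e default]) <;>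
      fin_cases i <;> rfl

theorem cappedPants_equivalent_comp (X : CrossedModule C P) (c : C) (g : P)
    (hk : X.bd c * g = X.bd 1 * (X.bd c * g)) :
    (cappedPantsLabels X c g (X.bd c * g) rfl).toCobordism.Equivalent
      (((cylinder X (Iso.toEmptySum (circle g))).comp
        ((disc X c).sum (identity X (circle g)))).comp
          (pants X 1 (X.bd c) g (X.bd c * g) hk)) := by
  set A := cylinder X (Iso.toEmptySum (circle g))
  set B := (disc X c).sum (identity X (circle g))
  set Q := pants X 1 (X.bd c) g (X.bd c * g) hk
  refine .rel _ _ (.iso _ _ (cappedPantsSide g) ⟨?_, ?_, ?_, ?_, ?_, ?_⟩)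
  · intro d
    change Fin 16 at d
    fin_cases d <;> rfl
  · intro d
    change Fin 16 at d
    have hAB : ∀ d : (A.comp B).Side, (∀ e, Sum.inr (B.outBd e) ≠ d) →
      compOpp (A.comp B) Q (Sum.inl d) = Sum.inl (compOpp A B d) := fun d hd =>
        compOpp_inl (A.comp B) Q d hd
    have hA' : ∀ i : Fin 4, i ≠ 0 →
        compOpp (A.comp B) Q (Sum.inl (Sum.inl ((default, i) : (circle g).Edge × Fin 4))) =
          Sum.inl (Sum.inl ((default, (![0, 3, 2, 1] : Fin 4 → Fin 4) i) :
            (circle g).Edge × Fin 4)) := by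
      intro i hi
      refine (hAB _ fun e h => by cases h).trans (congrArg Sum.inl ?_)
      exact (compOpp_inl A B _ fun e h => hi (congrArg Prod.snd h).symm).trans
        (congrArg Sum.inl (cylinder_circle_opp X g _ default i))
    have hB' : ∀ i : Fin 4, i ≠ 0 → i ≠ 2 →
        compOpp (A.comp B) Q
          (Sum.inl (Sum.inr (Sum.inr ((default, i) : (circle g).Edge × Fin 4)))) =
          Sum.inl (Sum.inr (Sum.inr ((default, (![0, 3, 2, 1] : Fin 4 → Fin 4) i) :
            (circle g).Edge × Fin 4))) := by
      intro i h0 h2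
      refine (hAB _ ?_).trans (congrArg Sum.inl ?_)
      · rintro ⟨e | e, l⟩ h
        · cases h
        · exact h0 (congrArg Prod.snd (Sum.inr_injective (Sum.inr_injective h))).symm
      · refine (compOpp_inr A B _ ?_).trans (congrArg (fun x => Sum.inr (Sum.inr x))
          (cylinder_circle_opp X g (Iso.refl _) default i))
        rintro ⟨e | e, l⟩ h
        · exact e.elim
        · exact h2 (congrArg Prod.snd (Sum.inr_injective h)).symm
    have hQ' : ∀ i : Fin 7, i ≠ 2 → i ≠ 5 →
        compOpp (A.comp B) Q (Sum.inr i) = Sum.inr (Q.opp i) := by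
      intro i h2 h5
      refine compOpp_inr _ _ _ ?_
      rintro ⟨e | e, l⟩ h
      · exact h5 h.symm
      · exact h2 h.symm
    -- The edges of the intermediate 1-manifolds: `eg` and `eg'` are copies of the edge of `(g)`,
    -- and `ec` is the boundary of the disc.
    let eg : (FormalOneManifold.empty.sum (circle g)).Edge := ⟨Sum.inr (), (0 : Fin 1)⟩
    let ec : ((circle (X.bd c)).sum (circle g)).Edge := ⟨Sum.inl (), (0 : Fin 1)⟩
    let eg' : ((circle (X.bd c)).sum (circle g)).Edge := ⟨Sum.inr (), (0 : Fin 1)⟩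
    fin_cases d
    · exact ((hAB _ fun e h => by cases h).trans
        (congrArg Sum.inl (compOpp_outBd A B eg))).symm
    · exact (hA' 1 (by decide)).symm
    · exact (hA' 2 (by decide)).symm
    · exact (hA' 3 (by decide)).symm
    · exact (compOpp_outBd (A.comp B) Q ec).symm
    · exact (compOpp_outBd (A.comp B) Q eg').symm
    · exact (hB' 1 (by decide) (by decide)).symm
    · refine ((hAB _ ?_).trans (congrArg Sum.inl (compOpp_inBd A B eg))).symm
      rintro ⟨e | e, l⟩ h
      · cases h
      · exact absurd (congrArg Prod.snd (Sum.inr_injective (Sum.inr_injective h)))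
          (show (0 : Fin 4) ≠ 2 by decide)
    · exact (hB' 3 (by decide) (by decide)).symm
    · exact (hQ' 0 (by decide) (by decide)).symm
    · exact (hQ' 1 (by decide) (by decide)).symm
    · exact (compOpp_inBd (A.comp B) Q eg').symm
    · exact (hQ' 3 (by decide) (by decide)).symm
    · exact (hQ' 4 (by decide) (by decide)).symm
    · exact (compOpp_inBd (A.comp B) Q ec).symm
    · exact (hQ' 6 (by decide) (by decide)).symm
  · intro e
    rw [Subsingleton.elim e default]
    rfl
  · intro e
    rfl
  · intro d
    change Fin 16 at d
    fin_cases d <;> rfl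
  · intro d
    change Fin 16 at d
    fin_cases d <;> first | rfl | exact smul_one _

/-- Multiplication of `(g)` by the disc `Disc(c)` is the annulus `(Cyl; c, g, 1)`. -/
theorem disc_pants_equivalent_annulus (X : CrossedModule C P) (c : C) (g : P)
    (hk : X.bd c * g = X.bd 1 * (X.bd c * g)) (hk' : X.bd c * g = X.bd c * (1⁻¹ * g * 1)) :
    (((cylinder X (Iso.toEmptySum (circle g))).comp
        ((disc X c).sum (identity X (circle g)))).comp
          (pants X 1 (X.bd c) g (X.bd c * g) hk)).Equivalent
      (annulus X c g 1 (X.bd c * g) hk') :=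
  (cappedPants_equivalent_comp X c g hk).symm
    |>.trans _ _ _ (cappedPants_equivalent X c g _ rfl)
    |>.trans _ _ _ (threeAnnuliSpur_equivalent X c g _ rfl)
    |>.trans _ _ _ (threeAnnuli_equivalent X c g _ rfl)
    |>.trans _ _ _ (longAndShort_equivalent X c g _ rfl)
    |>.trans _ _ _ (pathThreeSplit_equivalent X c g _ rfl).symm
    |>.trans _ _ _ (pathThreeSplit_equivalent_twoSpurs X c g _ rfl)
    |>.trans _ _ _ (twoSpurs_equivalent X c g _ rfl)
    |>.trans _ _ _ (spur_equivalent X c g _ rfl)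
    |>.trans _ _ _ (single_equivalent_annulus X c g _ rfl hk')

end Gluing

/-! ### Annuli in a formal HQFT -/

namespace FormalHQFT

variable {C : Type u} {P : Type v} [Group C] [Group P] [MulDistribMulAction P C]
  {X : CrossedModule C P} {K : Type w} [Field K] (τ : FormalHQFT X K)

/-- Annuli with inverse labels induce inverse maps. -/
theorem map_annulus_comp_inv (c c' : C) (g k : P) (hc : c' * c = 1)
    (h1 : k = X.bd c * (1⁻¹ * g * 1)) (h2 : g = X.bd c' * (1⁻¹ * k * 1)) (x : τ.L g) :
    τ.map (annulus X c' k 1 g h2) (τ.map (annulus X c g 1 k h1) x) = x := by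
  have h3 : g = X.bd (c' * c) * (1⁻¹ * g * 1) := by simp [hc]
  have h := τ.map_eq_of_equivalent _ _ (Gluing.annulus_comp_equivalent X c c' g k g h1 h2 h3)
  simp only [hc] at h
  rw [τ.map_eq_of_equivalent _ _ (Gluing.annulus_one_equivalent_identity X g (by simp)),
    τ.map_identity, τ.map_comp] at h
  exact LinearMap.congr_fun h x

theorem theta_bijective (c : C) (g : P) : Function.Bijective (τ.theta c g) :=
  Function.bijective_iff_has_inverse.2
    ⟨τ.map (annulus X c⁻¹ (X.bd c * g) 1 g (by simp)),
      τ.map_annulus_comp_inv c c⁻¹ g _ (inv_mul_cancel c) _ _,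
      τ.map_annulus_comp_inv c⁻¹ c _ g (mul_inv_cancel c) _ _⟩

theorem mu_discMap_eq_theta (c : C) (g : P) :
    τ.mu (X.bd c) g ∘ₗ (τ.discMap c).rTensor (τ.L g) ∘ₗ
      (TensorProduct.lid K (τ.L g)).symm.toLinearMap = τ.theta c g := by
  rw [theta, ← τ.map_eq_of_equivalent _ _
    (Gluing.disc_pants_equivalent_annulus X c g (by simp) (by simp)), τ.map_comp, τ.map_comp]
  ext x
  -- the left unit law: the cylinder of `(g) ≅ ∅ ⊔ (g)` inserts `1 ∈ K`
  have hx : τ.tensorIso _ _ (τ.map (cylinder X (Iso.toEmptySum (circle g))) x) =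
      τ.unitIso.symm.toLinearMap.rTensor (τ.L g) ((TensorProduct.lid K (τ.L g)).symm x) := by
    rw [LinearEquiv.symm_apply_eq _ |>.2 (τ.left_unit (circle g) x).symm,
      ← LinearMap.comp_apply, ← LinearMap.rTensor_comp]
    simp
  rw [LinearMap.comp_apply, LinearMap.comp_apply, LinearMap.comp_apply, LinearMap.comp_apply, mu,
    LinearMap.comp_apply]
  congr 1
  rw [LinearEquiv.coe_coe, LinearEquiv.symm_apply_eq, τ.map_sum, hx, τ.map_identity,
    ← LinearMap.comp_apply (TensorProduct.map _ _)]
  rfl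

theorem incl_theta (c : C) (g : P) (x : τ.L g) :
    τ.incl (X.bd c * g) (τ.theta c g x) =
      τ.mulL (τ.incl (X.bd c) (τ.tilde c)) (τ.incl g x) := by
  rw [← τ.mu_discMap_eq_theta]
  simp [incl, mulL, tilde]

end FormalHQFT

theorem mainTheorem11 {C : Type*} {P : Type*} [Group C] [Group P] [MulDistribMulAction P C]
    (X : CrossedModule C P) {K : Type*} [Field K] (τ : FormalHQFT X K) (c : C) (g : P) :
    (((cylinder X (Iso.toEmptySum (circle g))).comp
        ((disc X c).sum (identity X (circle g)))).comp
          (pants X 1 (X.bd c) g (X.bd c * g) (by simp))).Equivalent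
        (annulus X c g 1 (X.bd c * g) (by simp)) ∧
      Function.Bijective (τ.theta c g) ∧
      τ.mu (X.bd c) g ∘ₗ (τ.discMap c).rTensor (τ.L g) ∘ₗ
        (TensorProduct.lid K (τ.L g)).symm.toLinearMap = τ.theta c g ∧
      ∀ x : τ.L g, τ.incl (X.bd c * g) (τ.theta c g x) =
        τ.mulL (τ.incl (X.bd c) (τ.tilde c)) (τ.incl g x) :=
  ⟨Gluing.disc_pants_equivalent_annulus X c g _ _, τ.theta_bijective c g,
    τ.mu_discMap_eq_theta c g, τ.incl_theta c g⟩
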